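/- Let $p$ be a prime. For a finite group $G$ and a Sylow $p$-subgroup $T$ of $G$, let $\mathcal O_T(G)$ be the category whose objects are the subgroups of $T$ and whose morphisms $P\to Q$ are the $G$-equivariant maps $G/P\to G/Q$; each such map has the form $gP\mapsto gaQ$ for some $a\in G$. For an $\mathbb F_pG$-module $N$, let $F_N\colon\mathcal O_T(G)^{\mathrm{op}}\to\mathsf{Ab}$ be the functor with $F_N(1)=N$ and $F_N(P)=0$ for $P\neq 1$, where the endomorphism $g\mapsto ga$ of the object $1$ acts on $F_N(1)=N$ by $n\mapsto an$. For $i\ge 0$ set $$\Lambda^i(G;N)=\varprojlim\nolimits^{i}_{\mathcal O_T(G)}F_N ,$$ the value at $F_N$ of the $i$-th right derived functor of the inverse limit functor on functors $\mathcal O_T(G)^{\mathrm{op}}\to\mathsf{Ab}$. Let $\Gamma$ be a finite group with $p\mid|\Gamma|$, let $C_p$ be the cyclic group of order $p$, and let $\Gamma\wr C_p=\Gamma^p\rtimes C_p$ be the wreath product in which $C_p$ permutes the $p$ factors regularly. For an $\mathbb F_p\Gamma$-module $M$, let $\Gamma\wr C_p$ act on $M^p$ with $\Gamma^p$ acting coordinatewise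 and $C_p$ permuting the coordinates. Then for every $\mathbb F_p\Gamma$-module $M$, every $i\ge 1$, and all choices of the Sylow $p$-subgroups of $\Gamma\wr C_p$ and of $\Gamma$ used to define the two sides, there is an isomorphism of abelian groups $$\Lambda^i(\Gamma\wr C_p;M^p)\cong\Lambda^{i-1}(\Gamma;M).$$ -/

import Mathlib

open CategoryTheory CategoryTheory.Limits Opposite

universe u

instance presheafAb_isGrothendieckAbelian (C : Type u) [SmallCategory C] :
    IsGrothendieckAbelian.{u} (Cᵒᵖ ⥤ AddCommGrpCat.{u}) where
  ab5OfSize := ⟨fun _ _ _ => inferInstance⟩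

instance limAb_additive (C : Type u) [SmallCategory C] :
    (lim : (Cᵒᵖ ⥤ AddCommGrpCat.{u}) ⥤ AddCommGrpCat.{u}).Additive :=
  Functor.additive_of_preserves_binary_products _

/-- The `i`-th higher limit of `F : Cᵒᵖ ⥤ Ab`: the value at `F` of the `i`-th right derived functor
of the inverse limit functor `(Cᵒᵖ ⥤ Ab) ⥤ Ab`. -/
noncomputable def higherLimit {C : Type u} [SmallCategory C] (i : ℕ)
    (F : Cᵒᵖ ⥤ AddCommGrpCat.{u}) : AddCommGrpCat.{u} :=
  ((lim : (Cᵒᵖ ⥤ AddCommGrpCat.{u}) ⥤ AddCommGrpCat.{u}).rightDerived i).obj F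

/-- Objects of the orbit category `O_T(G)`: the subgroups of `G` that are contained in `T`. -/
@[ext]
structure OrbitCat {G : Type u} [Group G] (T : Subgroup G) : Type u where
  toSubgroup : Subgroup G
  le : toSubgroup ≤ T

namespace OrbitCat

/-- Morphisms `P ⟶ Q` in `O_T(G)` are the `G`-equivariant maps `G/P → G/Q`. -/
instance {G : Type u} [Group G] (T : Subgroup G) : SmallCategory (OrbitCat T) where
  Hom P Q := (G ⧸ P.toSubgroup) →[G] (G ⧸ Q.toSubgroup)
  id P := MulActionHom.id G
  comp f g := MulActionHom.comp g f

/-- A morphism `P ⟶ Q` as an equivariant map `G/P → G/Q`. -/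
def toMap {G : Type u} [Group G] {T : Subgroup G} {P Q : OrbitCat T} (φ : P ⟶ Q) :
    (G ⧸ P.toSubgroup) →[G] (G ⧸ Q.toSubgroup) := φ

/-- An element `a` of `G` with `φ (g P) = g a Q` for all `g`. It is unique up to
right multiplication by `Q`, hence unique if `Q = 1`. -/
noncomputable def rep {G : Type u} [Group G] {T : Subgroup G} {P Q : OrbitCat T} (φ : P ⟶ Q) : G :=
  (toMap φ ((1 : G) : G ⧸ P.toSubgroup)).out

theorem toMap_apply {G : Type u} [Group G] {T : Subgroup G} {P Q : OrbitCat T} (φ : P ⟶ Q)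
    (g : G) : toMap φ (g : G ⧸ P.toSubgroup) = ((g * rep φ : G) : G ⧸ Q.toSubgroup) := by
  have h : ((rep φ : G) : G ⧸ Q.toSubgroup) = toMap φ ((1 : G) : G ⧸ P.toSubgroup) :=
    QuotientGroup.out_eq' _
  have h2 := (toMap φ).map_smul g ((1 : G) : G ⧸ P.toSubgroup)
  rw [← h, MulAction.Quotient.smul_coe, MulAction.Quotient.smul_coe] at h2
  simpa using h2

theorem rep_inv_mul_mem {G : Type u} [Group G] {T : Subgroup G} {P Q : OrbitCat T} (φ : P ⟶ Q)
    (g : G) (hg : g ∈ P.toSubgroup) : (rep φ)⁻¹ * g * rep φ ∈ Q.toSubgroup := by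
  have h : ((g : G) : G ⧸ P.toSubgroup) = ((1 : G) : G ⧸ P.toSubgroup) :=
    QuotientGroup.eq.2 (by simpa using hg)
  have h2 := congrArg (toMap φ) h
  rw [toMap_apply, toMap_apply, eq_comm, QuotientGroup.eq] at h2
  simpa [mul_assoc] using h2

theorem eq_bot_of_hom {G : Type u} [Group G] {T : Subgroup G} {P Q : OrbitCat T} (φ : P ⟶ Q)
    (hQ : Q.toSubgroup = ⊥) : P.toSubgroup = ⊥ := by
  rw [Subgroup.eq_bot_iff_forall]
  intro g hg
  have h := rep_inv_mul_mem φ g hg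
  rw [hQ, Subgroup.mem_bot] at h
  have h2 : g = rep φ * ((rep φ)⁻¹ * g * rep φ) * (rep φ)⁻¹ := by group
  rw [h2, h]
  simp

theorem rep_eq {G : Type u} [Group G] {T : Subgroup G} {P Q : OrbitCat T} (φ : P ⟶ Q)
    (hQ : Q.toSubgroup = ⊥) (a : G)
    (h : toMap φ ((1 : G) : G ⧸ P.toSubgroup) = (a : G ⧸ Q.toSubgroup)) : rep φ = a := by
  rw [toMap_apply, QuotientGroup.eq, hQ, Subgroup.mem_bot, one_mul] at h
  exact inv_mul_eq_one.1 h

end OrbitCat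

open Classical in
/-- The group `F_M(P)`: it is `M` if `P = 1` and `0` otherwise. -/
noncomputable def atomicSubgroup {G : Type u} [Group G] (M : Type u) [AddCommGroup M]
    (P : Subgroup G) : AddSubgroup M :=
  if P = ⊥ then ⊤ else ⊥

theorem mem_atomicSubgroup {G : Type u} [Group G] {M : Type u} [AddCommGroup M]
    {P : Subgroup G} {m : M} : m ∈ atomicSubgroup M P ↔ (P ≠ ⊥ → m = 0) := by
  unfold atomicSubgroup
  split_ifs with h <;> simp [h]

/-- The functor `F_M : O_T(G)ᵒᵖ ⥤ Ab` that sends `1` to `M` and every other object to `0`. A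
morphism `φ` with `φ (g P) = g a Q` acts as `m ↦ a • m`. -/
noncomputable def atomicFunctor {G : Type u} [Group G] (T : Subgroup G) {k : Type*} [CommRing k]
    {M : Type u} [AddCommGroup M] [Module k M] (ρ : Representation k G M) :
    (OrbitCat T)ᵒᵖ ⥤ AddCommGrpCat.{u} where
  obj P := AddCommGrpCat.of (atomicSubgroup M P.unop.toSubgroup)
  map {Q P} φ := AddCommGrpCat.ofHom
    (((ρ (OrbitCat.rep φ.unop)).toAddMonoidHom.comp
        (atomicSubgroup M Q.unop.toSubgroup).subtype).codRestrict
      (atomicSubgroup M P.unop.toSubgroup) (fun m => by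
        rw [mem_atomicSubgroup]
        intro hP
        have hm := mem_atomicSubgroup.1 m.2 (fun hQ => hP (OrbitCat.eq_bot_of_hom φ.unop hQ))
        simp [hm]))
  map_id P := by
    ext m
    by_cases hP : P.unop.toSubgroup = ⊥
    · have h : OrbitCat.rep (𝟙 P.unop) = 1 := OrbitCat.rep_eq _ hP 1 rfl
      simp [h]
    · have hm := mem_atomicSubgroup.1 m.2 hP
      simp [hm]
  map_comp {R Q P} ψ φ := by
    ext m
    by_cases hR : R.unop.toSubgroup = ⊥
    · have h : OrbitCat.rep (φ.unop ≫ ψ.unop) =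
          OrbitCat.rep φ.unop * OrbitCat.rep ψ.unop := by
        refine OrbitCat.rep_eq _ hR _ ?_
        have h1 : OrbitCat.toMap (φ.unop ≫ ψ.unop) ((1 : G) : G ⧸ P.unop.toSubgroup) =
          OrbitCat.toMap ψ.unop (OrbitCat.toMap φ.unop ((1 : G) : G ⧸ P.unop.toSubgroup)) := rfl
        rw [h1, OrbitCat.toMap_apply, OrbitCat.toMap_apply, one_mul]
      simp [h]
    · have hm := mem_atomicSubgroup.1 m.2 hR
      simp [hm]

/-- `Λ^i(G; M)`, computed with the Sylow `p`-subgroup `T` of `G`: the `i`-th higher limit of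
`F_M` over the orbit category `O_T(G)`. -/
noncomputable def Lambda {p : ℕ} {G : Type u} [Group G] (T : Sylow p G) (i : ℕ)
    {k : Type*} [CommRing k] {M : Type u} [AddCommGroup M] [Module k M]
    (ρ : Representation k G M) : AddCommGrpCat.{u} :=
  higherLimit i (atomicFunctor (T : Subgroup G) ρ)

/-- The cyclic group of order `p`, written multiplicatively. -/
abbrev CyclicGroup (p : ℕ) : Type := Multiplicative (ZMod p)

/-- The module `M^p` over `Γ ≀ C_p`, with coordinates indexed by `C_p`: the base group `Γ^p` acts
coordinatewise and `C_p` permutes the coordinates by translation. -/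
def wreathRep {p : ℕ} {Γ : Type u} [Group Γ] {k : Type*} [CommRing k]
    {M : Type u} [AddCommGroup M] [Module k M] (ρ : Representation k Γ M) :
    Representation k (Γ ≀ᵣ CyclicGroup p) (CyclicGroup p → M) where
  toFun w :=
    { toFun := fun ξ x => ρ (w.left x) (ξ (w.right⁻¹ * x))
      map_add' := fun ξ η => by ext x; simp
      map_smul' := fun c ξ => by ext x; simp }
  map_one' := by ext ξ x; simp
  map_mul' w v := by ext ξ x; simp [mul_assoc]

/-! Write `W` for the wreath product and `B = Γ^p` for its base group. By Sylow's theorem the orbit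
category of a Sylow subgroup is equivalent to that of all `p`-subgroups (`lambda_iso`), so
everything takes place over the latter. There the atomic functor of `M^p` sits in a short exact
sequence `0 → F_{M^p} → E → D → 0`, where `E A` is `(M^p)^A` if `A ∩ B = 1` and `0` otherwise.
Vanishing of all higher limits of `E` then gives the shift by one.

Both `E` and `D` are right Kan extensions of atomic functors along functors of orbit categories.
Such an extension keeps higher limits whenever it is exact, which holds here because each comma
category is a disjoint union of categories with a terminal object
(`OrbInduction.isMultiLeftAdjoint`). Its values are spaces of equivariant functions on `G / A`
(`coindIsoFun`), and in this model the identifications are made by hand.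

For `E`: `M^p` is coinduced from `B`, which acts on `M` through one factor, so `E` is extended from
`B` and its higher limits are those of the atomic functor of `M` over `Γ × Γ^(p-1)`. The second
factor acts trivially and `p` divides its order, so they vanish
(`isZero_higherLimit_orbAtomic_prod`): a transfer reduces the second factor to its Sylow subgroup,
and for a nontrivial `p`-group an extension to the subgroups containing that factor is zero.

For `D`: a nontrivial `A` with `A ∩ B = 1` is conjugate to `C_p` (`exists_conjLE_topSubgroup`), the
fixed points of `C_p` on `M^p` are the diagonal copy of `M`, and the centralizer of `C_p` is `Γ ×
C_p`. Hence `D` is the extension of the atomic functor of `M` along `P ↦ P × C_p`, with `P` embedded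
diagonally, and has the higher limits of that functor over `Γ`. -/

/-! ### Higher limits and exact functors that preserve limits and injectives -/

section HigherLimits

variable {C D : Type u} [SmallCategory C] [SmallCategory D]

/-- Isomorphic functors have isomorphic higher limits. -/
noncomputable def higherLimitIso (i : ℕ) {F F' : Cᵒᵖ ⥤ AddCommGrpCat.{u}} (e : F ≅ F') :
    higherLimit i F ≅ higherLimit i F' :=
  ((lim : (Cᵒᵖ ⥤ AddCommGrpCat.{u}) ⥤ AddCommGrpCat.{u}).rightDerived i).mapIso e

/-- If the higher limits of `F'` vanish, so do those of its retracts. -/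
theorem isZero_higherLimit_of_retract (i : ℕ) {F F' : Cᵒᵖ ⥤ AddCommGrpCat.{u}}
    (s : F ⟶ F') (r : F' ⟶ F) (h : s ≫ r = 𝟙 F) (hF' : IsZero (higherLimit i F')) :
    IsZero (higherLimit i F) := by
  let L := (lim : (Cᵒᵖ ⥤ AddCommGrpCat.{u}) ⥤ AddCommGrpCat.{u}).rightDerived i
  change IsZero (L.obj F)
  rw [IsZero.iff_id_eq_zero, ← L.map_id, ← h, L.map_comp,
    IsZero.eq_of_tgt (X := L.obj F') hF' (L.map s) 0, zero_comp]

/-- The zeroth higher limit is the limit. -/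
noncomputable def higherLimitZeroIso (F : Cᵒᵖ ⥤ AddCommGrpCat.{u}) :
    higherLimit 0 F ≅ lim.obj F :=
  (lim : (Cᵒᵖ ⥤ AddCommGrpCat.{u}) ⥤ AddCommGrpCat.{u}).rightDerivedZeroIsoSelf.app F

/-- The image of an injective resolution under an exact functor that preserves injectives. -/
noncomputable def mapInjRes {A B : Type*} [Category* A] [Abelian A] [Category* B] [Abelian B]
    (R : A ⥤ B) [R.Additive] [R.PreservesHomology] [R.PreservesInjectiveObjects] {Z : A}
    (I : InjectiveResolution Z) : InjectiveResolution (R.obj Z) where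
  cocomplex := (R.mapHomologicalComplex _).obj I.cocomplex
  injective n := Functor.PreservesInjectiveObjects.injective_obj (I.injective n)
  ι := (HomologicalComplex.singleMapHomologicalComplex _ _ _).inv.app _ ≫
    (R.mapHomologicalComplex _).map I.ι
  quasiIso := inferInstance

/-- Higher limits do not change under an exact functor that preserves injectives and limits. -/
theorem higherLimit_iso_of_exact
    (R : (Dᵒᵖ ⥤ AddCommGrpCat.{u}) ⥤ (Cᵒᵖ ⥤ AddCommGrpCat.{u})) [R.Additive]
    [R.PreservesHomology] [R.PreservesInjectiveObjects] (e : R ⋙ lim ≅ lim)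
    (i : ℕ) (F : Dᵒᵖ ⥤ AddCommGrpCat.{u}) :
    Nonempty (higherLimit i (R.obj F) ≅ higherLimit i F) := by
  let I := injectiveResolution F
  refine ⟨(mapInjRes R I).isoRightDerivedObj lim i ≪≫ ?_ ≪≫ (I.isoRightDerivedObj lim i).symm⟩
  -- Both sides are now homology of complexes of limits, and `e` identifies these complexes degree
  -- by degree.
  refine (HomologicalComplex.homologyFunctor _ _ i).mapIso ?_
  refine HomologicalComplex.Hom.isoOfComponents (fun n => e.app (I.cocomplex.X n)) ?_
  intro n m _
  exact (e.hom.naturality (I.cocomplex.d n m)).symm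

end HigherLimits

/-! ### Higher limits as Ext groups, and dimension shifting -/

section ExtComparison

variable (C : Type u) [SmallCategory C]

/-- The constant functor with value `ℤ`. -/
noncomputable abbrev constInt : Cᵒᵖ ⥤ AddCommGrpCat.{u} :=
  (Functor.const Cᵒᵖ).obj (AddCommGrpCat.of (ULift.{u} ℤ))

variable {C}

/-- Homomorphisms from `ℤ` to an abelian group `A` correspond to elements of `A`. -/
noncomputable def homUliftInt (A : AddCommGrpCat.{u}) :
    (AddCommGrpCat.of (ULift.{u} ℤ) ⟶ A) ≃ A where
  toFun f := f.hom (ULift.up 1)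
  invFun a := AddCommGrpCat.ofHom
    (((zmultiplesHom A a : ℤ →+ A)).comp (AddEquiv.ulift : ULift.{u} ℤ ≃+ ℤ).toAddMonoidHom)
  left_inv f := by
    ext x
    change x.down • f.hom (ULift.up 1) = f.hom x
    rw [← map_zsmul f.hom]
    congr 1
    ext
    simp
  right_inv a := one_zsmul a

/-- Morphisms from the constant functor `ℤ` correspond to elements of the limit. -/
noncomputable def homConstInt (F : Cᵒᵖ ⥤ AddCommGrpCat.{u}) :
    (lim.obj F : AddCommGrpCat.{u}) ≃+ (constInt C ⟶ F) :=
  (AddEquiv.mk' ((constLimAdj.homEquiv (AddCommGrpCat.of (ULift.{u} ℤ)) F).trans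
    (homUliftInt _)) (fun f g => by
        have : (constLimAdj.homEquiv (AddCommGrpCat.of (ULift.{u} ℤ)) F) (f + g) =
            (constLimAdj.homEquiv (AddCommGrpCat.of (ULift.{u} ℤ)) F) f +
            (constLimAdj.homEquiv (AddCommGrpCat.of (ULift.{u} ℤ)) F) g := by
          rw [Adjunction.homEquiv_unit, Adjunction.homEquiv_unit, Adjunction.homEquiv_unit,
            Functor.map_add, Preadditive.comp_add]
        simp only [Equiv.trans_apply, this]
        rfl)).symm

theorem homConstInt_comp {F F' : Cᵒᵖ ⥤ AddCommGrpCat.{u}} (f : F ⟶ F')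
    (z : (lim.obj F : AddCommGrpCat.{u})) :
    homConstInt F z ≫ f = homConstInt F' ((lim.map f).hom z) := by
  rw [← AddEquiv.symm_apply_eq]
  obtain ⟨g, rfl⟩ := (homConstInt F).symm.surjective z
  rw [AddEquiv.apply_symm_apply]
  change (constLimAdj.homEquiv (AddCommGrpCat.of (ULift.{u} ℤ)) F') (g ≫ f) (ULift.up 1) =
    (lim.map f) ((constLimAdj.homEquiv (AddCommGrpCat.of (ULift.{u} ℤ)) F) g (ULift.up 1))
  rw [Adjunction.homEquiv_naturality_right]
  rfl

/-- Higher limits in positive degrees are extension groups of the constant functor `ℤ`. -/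
theorem higherLimit_addEquiv_ext (p : ℕ) (F : Cᵒᵖ ⥤ AddCommGrpCat.{u}) :
    Nonempty (higherLimit (p + 1) F ≃+ Abelian.Ext.{u} (constInt C) F (p + 1)) := by
  let I := injectiveResolution F
  let K := ((lim : (Cᵒᵖ ⥤ AddCommGrpCat.{u}) ⥤ AddCommGrpCat.{u}).mapHomologicalComplex
    (ComplexShape.up ℕ)).obj I.cocomplex
  let X := fun n => I.cocomplex.X n
  let d₁ : X p ⟶ X (p + 1) := I.cocomplex.d p (p + 1)
  let d₂ : X (p + 1) ⟶ X (p + 2) := I.cocomplex.d (p + 1) (p + 2)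
  let S : ShortComplex AddCommGrpCat.{u} := ShortComplex.mk (lim.map d₁) (lim.map d₂)
    (by rw [← lim.map_comp, I.cocomplex.d_comp_d, Functor.map_zero])
  have hcoc : ∀ z : (lim.obj (X (p + 1)) : AddCommGrpCat.{u}), (lim.map d₂).hom z = 0 →
      homConstInt (X (p + 1)) z ≫ d₂ = 0 := fun z hz => by
    rw [homConstInt_comp, hz, map_zero]
  -- Since the limit is `Hom(ℤ, -)`, cycles in the complex of limits are cocycles representing Ext
  -- classes. Below, the kernel of `φ` turns out to be the boundaries.
  let φ : AddMonoidHom.ker (lim.map d₂).hom →+ Abelian.Ext.{u} (constInt C) F (p + 1) :=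
    AddMonoidHom.mk' (fun z => I.extMk (homConstInt (X (p + 1)) z.1) (p + 2) rfl
      (hcoc z.1 z.2)) (fun a b => by
        rw [InjectiveResolution.add_extMk]
        congr 1
        exact map_add (homConstInt (X (p + 1))) a.1 b.1)
  have hφ : Function.Surjective φ := fun α => by
    obtain ⟨f, hf, rfl⟩ := I.extMk_surjective α (p + 2) rfl
    obtain ⟨z, rfl⟩ := (homConstInt (X (p + 1))).surjective f
    refine ⟨⟨z, ?_⟩, rfl⟩
    rw [homConstInt_comp] at hf
    exact (homConstInt (X (p + 2))).map_eq_zero_iff.1 hf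
  have hker : AddMonoidHom.range S.abToCycles = φ.ker := by
    ext z
    rw [AddMonoidHom.mem_ker, AddMonoidHom.mem_range]
    refine Iff.trans ?_ (I.extMk_eq_zero_iff _ (p + 2) rfl (hcoc z.1 z.2) p rfl).symm
    constructor
    · rintro ⟨y, rfl⟩
      exact ⟨homConstInt (X p) y, homConstInt_comp d₁ y⟩
    · rintro ⟨g, hg⟩
      obtain ⟨y, rfl⟩ := (homConstInt (X p)).surjective g
      rw [homConstInt_comp] at hg
      exact ⟨y, Subtype.ext ((homConstInt (X (p + 1))).injective hg)⟩
  have e₁ : higherLimit (p + 1) F ≅ S.homology := I.isoRightDerivedObj lim (p + 1) ≪≫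
    ShortComplex.homologyMapIso (K.isoSc' p (p + 1) (p + 2) (by simp) (by simp))
  exact ⟨((e₁ ≪≫ S.abHomologyIso).addCommGroupIsoToAddEquiv).trans
    ((QuotientAddGroup.quotientAddEquivOfEq hker).trans
      (QuotientAddGroup.quotientKerEquivOfSurjective φ hφ))⟩

/-- In a short exact sequence whose middle term has no higher limits, the higher limits of the
outer terms agree up to a shift. -/
theorem higherLimit_succ_iso_of_shortExact {S : ShortComplex (Cᵒᵖ ⥤ AddCommGrpCat.{u})}
    (hS : S.ShortExact) (h : ∀ i, IsZero (higherLimit i S.X₂)) (i : ℕ) :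
    Nonempty (higherLimit (i + 1) S.X₁ ≅ higherLimit i S.X₃) := by
  have hX₂ : ∀ n (x : Abelian.Ext.{u} (constInt C) S.X₂ n), x = 0 := fun n x => by
    cases n with
    | zero =>
      have h0 : IsZero (lim.obj S.X₂ : AddCommGrpCat.{u}) :=
        (h 0).of_iso (higherLimitZeroIso S.X₂).symm
      have hsub := AddCommGrpCat.subsingleton_of_isZero h0
      obtain ⟨z, hz⟩ := (homConstInt S.X₂).surjective (Abelian.Ext.homEquiv₀ x)
      rw [← Abelian.Ext.mk₀_homEquiv₀_apply x, ← hz, Subsingleton.elim z 0, map_zero,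
        Abelian.Ext.mk₀_zero]
    | succ p =>
      obtain ⟨e⟩ := higherLimit_addEquiv_ext p S.X₂
      have hsub := AddCommGrpCat.subsingleton_of_isZero (h (p + 1))
      exact e.symm.injective (Subsingleton.elim _ _)
  let δ : Abelian.Ext.{u} (constInt C) S.X₃ i →+ Abelian.Ext.{u} (constInt C) S.X₁ (i + 1) :=
    AddMonoidHom.mk' (fun x => x.comp hS.extClass rfl) (fun a b => by simp)
  -- The neighbours of the connecting map in the long exact sequence are Ext groups of the middle
  -- term, which are zero.
  have hδ : Function.Bijective δ := by
    constructor
    · rw [injective_iff_map_eq_zero]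
      intro x hx
      obtain ⟨y, rfl⟩ := Abelian.Ext.covariant_sequence_exact₃ _ hS x rfl hx
      rw [hX₂ _ y, Abelian.Ext.zero_comp]
    · intro x
      exact Abelian.Ext.covariant_sequence_exact₁ _ hS x (hX₂ _ _) rfl
  obtain ⟨e₁⟩ := higherLimit_addEquiv_ext i S.X₁
  have e₃ : Nonempty (higherLimit i S.X₃ ≃+ Abelian.Ext.{u} (constInt C) S.X₃ i) := by
    cases i with
    | zero =>
      exact ⟨(higherLimitZeroIso S.X₃).addCommGroupIsoToAddEquiv.trans
        ((homConstInt S.X₃).trans Abelian.Ext.addEquiv₀.symm)⟩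
    | succ p => exact higherLimit_addEquiv_ext p S.X₃
  obtain ⟨e₃⟩ := e₃
  exact ⟨(e₁.trans ((AddEquiv.ofBijective δ hδ).symm.trans e₃.symm)).toAddCommGrpIso⟩

end ExtComparison

/-! ### Right Kan extension and a Shapiro lemma for higher limits -/

section Coinduction

variable {C D : Type u} [SmallCategory C] [SmallCategory D] (Φ : D ⥤ C)

/-- The value at `c` of the right Kan extension of `F` along `Φ`: the compatible families of
elements of `F d`, indexed by the morphisms `Φ d ⟶ c`. -/
def coindSubgroup (F : Dᵒᵖ ⥤ AddCommGrpCat.{u}) (c : C) :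
    AddSubgroup (∀ d : D, (Φ.obj d ⟶ c) → F.obj (op d)) where
  carrier := {s | ∀ (d d' : D) (v : d ⟶ d') (f : Φ.obj d' ⟶ c),
    s d (Φ.map v ≫ f) = (F.map v.op).hom (s d' f)}
  zero_mem' := fun d d' v f => (map_zero _).symm
  add_mem' := fun {a b} ha hb d d' v f => by
    simp only [Pi.add_apply, ha d d' v f, hb d d' v f, map_add]
  neg_mem' := fun {a} ha d d' v f => by
    simp only [Pi.neg_apply, ha d d' v f, map_neg]

variable {Φ}

theorem coindSubgroup_ext {F : Dᵒᵖ ⥤ AddCommGrpCat.{u}} {c : C} {s t : coindSubgroup Φ F c}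
    (h : ∀ d f, s.1 d f = t.1 d f) : s = t :=
  Subtype.ext (funext fun d => funext fun f => h d f)

variable (Φ) in
/-- The right Kan extension of presheaves of abelian groups along a functor `Φ`. -/
def coind : (Dᵒᵖ ⥤ AddCommGrpCat.{u}) ⥤ (Cᵒᵖ ⥤ AddCommGrpCat.{u}) where
  obj F :=
    { obj := fun c => AddCommGrpCat.of (coindSubgroup Φ F c.unop)
      map := fun {c c'} φ => AddCommGrpCat.ofHom
        (AddMonoidHom.mk' (fun s => ⟨fun d f => s.1 d (f ≫ φ.unop), fun d d' v f => by
          beta_reduce; rw [Category.assoc]; exact s.2 d d' v _⟩) (fun _ _ => rfl))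
      map_id := fun c => by
        refine AddCommGrpCat.hom_ext (AddMonoidHom.ext fun s => coindSubgroup_ext fun d f => ?_)
        exact congrArg (s.1 d) (Category.comp_id f)
      map_comp := fun {a b c} φ ψ => by
        refine AddCommGrpCat.hom_ext (AddMonoidHom.ext fun s => coindSubgroup_ext fun d f => ?_)
        exact congrArg (s.1 d) (Category.assoc f ψ.unop φ.unop).symm }
  map {F F'} α :=
    { app := fun c => AddCommGrpCat.ofHom
        (AddMonoidHom.mk' (fun s => ⟨fun d f => (α.app (op d)).hom (s.1 d f), fun d d' v f => by
          beta_reduce; rw [s.2 d d' v f]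
          exact congrArg (fun g => g.hom (s.1 d' f)) (α.naturality v.op)⟩)
          (fun s t => coindSubgroup_ext fun d f => map_add (α.app (op d)).hom (s.1 d f) (t.1 d f)))
      naturality := fun c c' φ => rfl }
  map_id F := rfl
  map_comp α β := rfl

variable (Φ) in
/-- Right Kan extension is right adjoint to restriction. -/
def coindAdj : (Functor.whiskeringLeft Dᵒᵖ Cᵒᵖ AddCommGrpCat.{u}).obj Φ.op ⊣ coind Φ :=
  Adjunction.mkOfHomEquiv
    { homEquiv := fun A F =>
        { toFun := fun α =>
            { app := fun c => AddCommGrpCat.ofHom (AddMonoidHom.mk'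
                (fun a => ⟨fun d f => (α.app (op d)).hom ((A.map f.op).hom a),
                  fun d d' v f => by
                    beta_reduce; rw [op_comp, A.map_comp]
                    exact congrArg (fun g => g.hom ((A.map f.op).hom a)) (α.naturality v.op)⟩)
                (fun a b => coindSubgroup_ext fun d f => by
                  change (α.app (op d)).hom ((A.map f.op).hom (a + b)) =
                    (α.app (op d)).hom ((A.map f.op).hom a) +
                    (α.app (op d)).hom ((A.map f.op).hom b)
                  rw [map_add, map_add]))
              naturality := fun c c' φ => by
                ext a
                refine coindSubgroup_ext fun d f => ?_
                change (α.app (op d)).hom ((A.map f.op).hom ((A.map φ).hom a)) =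
                  (α.app (op d)).hom ((A.map (f ≫ φ.unop).op).hom a)
                rw [op_comp, A.map_comp]
                rfl }
          invFun := fun β =>
            { app := fun d => AddCommGrpCat.ofHom (AddMonoidHom.mk'
                (fun a => ((β.app (op (Φ.obj d.unop))).hom a).1 d.unop (𝟙 _))
                (fun a b => by rw [map_add]; rfl))
              naturality := fun d d' v => by
                ext a
                have h := congrArg (fun g => (g.hom a).1 d'.unop (𝟙 _))
                  (β.naturality (Φ.map v.unop).op)
                refine h.trans ?_
                have h2 := ((β.app (op (Φ.obj d.unop))).hom a).2 d'.unop d.unop v.unop (𝟙 _)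
                rw [Category.comp_id] at h2
                refine Eq.trans ?_ h2
                exact congrArg (((β.app (op (Φ.obj d.unop))).hom a).1 d'.unop)
                  (Category.id_comp _) }
          left_inv := fun α => by
            ext d a
            change (α.app d).hom ((A.map (𝟙 _)).hom a) = (α.app d).hom a
            rw [A.map_id]
            rfl
          right_inv := fun β => by
            ext c a
            refine coindSubgroup_ext fun d f => ?_
            have h := congrArg (fun g => (g.hom a).1 d (𝟙 _)) (β.naturality f.op)
            refine h.trans ?_
            exact congrArg (((β.app c).hom a).1 d) (Category.id_comp f) }
      homEquiv_naturality_left_symm := fun f g => rfl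
      homEquiv_naturality_right := fun f g => rfl }

instance : (coind Φ).IsRightAdjoint := (coindAdj Φ).isRightAdjoint

instance : (coind Φ).Additive := ⟨rfl⟩

instance : PreservesLimits (coind Φ) := (coindAdj Φ).rightAdjoint_preservesLimits

instance : (coind Φ).PreservesInjectiveObjects :=
  haveI : ((Functor.whiskeringLeft Dᵒᵖ Cᵒᵖ AddCommGrpCat.{u}).obj
    Φ.op).PreservesMonomorphisms := inferInstance
  Functor.preservesInjectiveObjects_of_adjunction_of_preservesMonomorphisms (coindAdj Φ)

variable (Φ) in
/-- Right Kan extension does not change limits. -/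
noncomputable def coindLimIso : coind Φ ⋙ lim ≅ lim :=
  -- Restriction along `Φ` takes constant presheaves to constant presheaves, so both functors are
  -- right adjoint to the constant presheaf functor.
  Adjunction.rightAdjointUniq
    (((constLimAdj (J := Cᵒᵖ) (C := AddCommGrpCat.{u})).comp (coindAdj Φ)).ofNatIsoLeft
      (Iso.refl (Functor.const Dᵒᵖ))) constLimAdj

variable (Φ) in
/-- Every morphism `Φ d ⟶ c` factors uniquely through exactly one of a family of
morphisms `Φ (t j) ⟶ c`. -/
def IsMultiLeftAdjoint : Prop :=
  ∀ c : C, ∃ (J : Type u) (t : J → D) (ε : ∀ j, Φ.obj (t j) ⟶ c),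
    ∀ (d : D) (f : Φ.obj d ⟶ c), ∃! x : Σ j, d ⟶ t j, Φ.map x.2 ≫ ε x.1 = f

/-- The comma category over `c` is a disjoint union of categories with terminal objects `t j`, so a
compatible family amounts to a free choice of one element of `F (t j)` for each `j`. A product of
surjections of abelian groups is surjective. -/
theorem IsMultiLeftAdjoint.coind_preservesEpi (hΦ : IsMultiLeftAdjoint Φ) :
    (coind Φ).PreservesEpimorphisms where
  preserves {F F'} α hα := by
    have hα' : ∀ d, Function.Surjective (α.app d).hom := fun d => by
      have := (NatTrans.epi_iff_epi_app α).1 hα d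
      exact (AddCommGrpCat.epi_iff_surjective _).1 this
    rw [NatTrans.epi_iff_epi_app]
    rintro ⟨c⟩
    rw [AddCommGrpCat.epi_iff_surjective]
    intro (s : coindSubgroup Φ F' c)
    obtain ⟨J, t, ε, h⟩ := hΦ c
    choose x hx hux using h
    choose y hy using fun j => hα' (op (t j)) (s.1 (t j) (ε j))
    refine ⟨(⟨fun d f => (F.map (x d f).2.op).hom (y (x d f).1), ?_⟩ : coindSubgroup Φ F c), ?_⟩
    · intro d d' v f
      -- Uniqueness of the factorization is what makes the lifted family compatible.
      have h1 : (⟨(x d' f).1, v ≫ (x d' f).2⟩ : Σ j, d ⟶ t j) = x d (Φ.map v ≫ f) := by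
        refine hux d (Φ.map v ≫ f) _ ?_
        simp only [Functor.map_comp, Category.assoc]
        rw [hx]
      beta_reduce
      rw [← h1, op_comp, F.map_comp]
      rfl
    · refine coindSubgroup_ext fun d f => ?_
      change (α.app (op d)).hom ((F.map (x d f).2.op).hom (y (x d f).1)) = s.1 d f
      have h1 := congrArg (fun g => g.hom (y (x d f).1)) (α.naturality (x d f).2.op)
      refine h1.trans ?_
      change (F'.map (x d f).2.op).hom ((α.app _).hom (y (x d f).1)) = _
      rw [hy, ← s.2, hx]

theorem IsMultiLeftAdjoint.coind_preservesHomology (hΦ : IsMultiLeftAdjoint Φ) :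
    (coind Φ).PreservesHomology := by
  have := hΦ.coind_preservesEpi
  refine ((Functor.exact_tfae (coind Φ)).out 0 2).1 fun S hS => ?_
  have hlim : PreservesFiniteLimits (coind Φ) := inferInstance
  have hS' := (Functor.preservesFiniteLimits_iff_forall_exact_map_and_mono (coind Φ)).1 hlim S hS
  have := hS.epi_g
  have hg : Epi ((coind Φ).map S.g) := inferInstance
  exact { exact := hS'.1, mono_f := hS'.2, epi_g := hg }

/-- Higher limits do not change under right Kan extension along a functor with a multi right
adjoint. -/
theorem IsMultiLeftAdjoint.higherLimit_coind_iso (hΦ : IsMultiLeftAdjoint Φ) (i : ℕ)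
    (F : Dᵒᵖ ⥤ AddCommGrpCat.{u}) :
    Nonempty (higherLimit i ((coind Φ).obj F) ≅ higherLimit i F) :=
  have := hΦ.coind_preservesHomology
  higherLimit_iso_of_exact (coind Φ) (coindLimIso Φ) i F

/-- Higher limits do not change under restriction along an equivalence. -/
theorem higherLimit_comp_iso_of_isEquivalence [Φ.IsEquivalence] (i : ℕ)
    (F : Cᵒᵖ ⥤ AddCommGrpCat.{u}) :
    Nonempty (higherLimit i (Φ.op ⋙ F) ≅ higherLimit i F) :=
  have : Φ.op.IsEquivalence := inferInstance
  have : ((Functor.whiskeringLeft Dᵒᵖ Cᵒᵖ AddCommGrpCat.{u}).obj Φ.op).IsEquivalence :=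
    inferInstance
  higherLimit_iso_of_exact ((Functor.whiskeringLeft Dᵒᵖ Cᵒᵖ AddCommGrpCat.{u}).obj Φ.op)
    (Functor.Initial.limIso Φ.op) i F

end Coinduction

/-! ### Orbit categories on a family of subgroups -/

section Orb

variable {G : Type u} [Group G]

/-- `ConjLE g P A` says that `g⁻¹ P g ≤ A`, that is, `P` fixes the point `g A` of `G / A`. -/
def ConjLE (g : G) (P A : Subgroup G) : Prop := ∀ y ∈ P, g⁻¹ * y * g ∈ A

theorem ConjLE.comp {g h : G} {P Q A : Subgroup G} (h₁ : ConjLE g P Q) (h₂ : ConjLE h Q A) :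
    ConjLE (g * h) P A := fun y hy => by
  have := h₂ _ (h₁ y hy)
  simpa [mul_assoc] using this

theorem ConjLE.of_le {P A : Subgroup G} (h : P ≤ A) : ConjLE 1 P A := fun y hy => by
  simpa using h hy

theorem ConjLE.mul_right {g a : G} {P A : Subgroup G} (h : ConjLE g P A) (ha : a ∈ A) :
    ConjLE (g * a) P A := fun y hy => by
  have := A.mul_mem (A.mul_mem (A.inv_mem ha) (h y hy)) ha
  simpa [mul_assoc] using this

theorem ConjLE.congr {g g' : G} {P A : Subgroup G} (h : ConjLE g P A) (ha : g⁻¹ * g' ∈ A) :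
    ConjLE g' P A := by
  simpa using h.mul_right ha

theorem ConjLE.congr_iff {g g' : G} {P A : Subgroup G} (ha : g⁻¹ * g' ∈ A) :
    ConjLE g P A ↔ ConjLE g' P A :=
  ⟨fun h => h.congr ha, fun h => h.congr (by simpa using A.inv_mem ha)⟩

/-- Objects of the orbit category of `G` on a family `𝓕` of subgroups. -/
structure Orb (𝓕 : Set (Subgroup G)) : Type u where
  sub : Subgroup G
  mem : sub ∈ 𝓕

namespace Orb

variable {𝓕 : Set (Subgroup G)}

/-- Morphisms `P ⟶ Q` are the `G`-equivariant maps `G/P → G/Q`. -/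
instance : SmallCategory (Orb 𝓕) where
  Hom P Q := (G ⧸ P.sub) →[G] (G ⧸ Q.sub)
  id P := MulActionHom.id G
  comp f g := MulActionHom.comp g f

/-- A morphism as an equivariant map. -/
def toMap {P Q : Orb 𝓕} (φ : P ⟶ Q) : (G ⧸ P.sub) →[G] (G ⧸ Q.sub) := φ

/-- The morphism `g P ↦ g a Q`. -/
def homMk {P Q : Orb 𝓕} (a : G) (h : ConjLE a P.sub Q.sub) : P ⟶ Q :=
  show (G ⧸ P.sub) →[G] (G ⧸ Q.sub) from
  { toFun := fun x => Quotient.liftOn' x (fun g => ((g * a : G) : G ⧸ Q.sub)) (fun g g' hg => by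
      rw [QuotientGroup.leftRel_apply] at hg
      rw [QuotientGroup.eq]
      have := h _ hg
      simpa [mul_assoc] using this)
    map_smul' := fun g x => by
      induction x using QuotientGroup.induction_on with
      | H y => exact congrArg (fun z : G => (z : G ⧸ Q.sub)) (mul_assoc g y a) }

theorem toMap_homMk {P Q : Orb 𝓕} (a : G) (h : ConjLE a P.sub Q.sub) (g : G) :
    toMap (homMk a h) (g : G ⧸ P.sub) = ((g * a : G) : G ⧸ Q.sub) := rfl

/-- An element `a` such that the morphism is `g P ↦ g a Q`. -/
noncomputable def rep {P Q : Orb 𝓕} (φ : P ⟶ Q) : G :=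
  (toMap φ ((1 : G) : G ⧸ P.sub)).out

theorem toMap_apply {P Q : Orb 𝓕} (φ : P ⟶ Q) (g : G) :
    toMap φ (g : G ⧸ P.sub) = ((g * rep φ : G) : G ⧸ Q.sub) := by
  have h : ((rep φ : G) : G ⧸ Q.sub) = toMap φ ((1 : G) : G ⧸ P.sub) :=
    QuotientGroup.out_eq' _
  have h2 := (toMap φ).map_smul g ((1 : G) : G ⧸ P.sub)
  rw [← h, MulAction.Quotient.smul_coe, MulAction.Quotient.smul_coe] at h2
  simpa using h2

theorem hom_ext {P Q : Orb 𝓕} {φ ψ : P ⟶ Q}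
    (h : ∀ g : G, toMap φ (g : G ⧸ P.sub) = toMap ψ (g : G ⧸ P.sub)) : φ = ψ :=
  MulActionHom.ext fun x => by
    induction x using QuotientGroup.induction_on with
    | H y => exact h y

theorem conjLE_rep {P Q : Orb 𝓕} (φ : P ⟶ Q) : ConjLE (rep φ) P.sub Q.sub := fun y hy => by
  have h : ((y : G) : G ⧸ P.sub) = ((1 : G) : G ⧸ P.sub) :=
    QuotientGroup.eq.2 (by simpa using hy)
  have h2 := congrArg (toMap φ) h
  rw [toMap_apply, toMap_apply, eq_comm, QuotientGroup.eq] at h2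
  simpa [mul_assoc] using h2

theorem homMk_eq_iff {P Q : Orb 𝓕} {a b : G} (ha : ConjLE a P.sub Q.sub)
    (hb : ConjLE b P.sub Q.sub) : homMk a ha = homMk b hb ↔ a⁻¹ * b ∈ Q.sub := by
  constructor
  · intro h
    have h1 := congrArg (fun φ => toMap φ ((1 : G) : G ⧸ P.sub)) h
    simp only [toMap_homMk, one_mul] at h1
    exact QuotientGroup.eq.1 h1
  · intro h
    refine hom_ext fun g => ?_
    rw [toMap_homMk, toMap_homMk, QuotientGroup.eq]
    simpa [mul_assoc] using h

theorem homMk_rep {P Q : Orb 𝓕} (φ : P ⟶ Q) : homMk (rep φ) (conjLE_rep φ) = φ :=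
  hom_ext fun g => by rw [toMap_homMk, toMap_apply]

theorem rep_homMk {P Q : Orb 𝓕} (a : G) (h : ConjLE a P.sub Q.sub) :
    (rep (homMk a h))⁻¹ * a ∈ Q.sub :=
  (homMk_eq_iff (conjLE_rep _) h).1 (homMk_rep _)

theorem toMap_comp {P Q R : Orb 𝓕} (φ : P ⟶ Q) (ψ : Q ⟶ R) (x : G ⧸ P.sub) :
    toMap (φ ≫ ψ) x = toMap ψ (toMap φ x) := rfl

theorem homMk_comp {P Q R : Orb 𝓕} (a b : G) (ha : ConjLE a P.sub Q.sub)
    (hb : ConjLE b Q.sub R.sub) : homMk a ha ≫ homMk b hb = homMk (a * b) (ha.comp hb) :=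
  hom_ext fun g => by
    rw [toMap_comp, toMap_homMk, toMap_homMk, toMap_homMk, mul_assoc]

theorem rep_comp {P Q R : Orb 𝓕} (φ : P ⟶ Q) (ψ : Q ⟶ R) :
    (rep (φ ≫ ψ))⁻¹ * (rep φ * rep ψ) ∈ R.sub := by
  rw [← homMk_eq_iff (conjLE_rep _) ((conjLE_rep φ).comp (conjLE_rep ψ)), homMk_rep,
    ← homMk_comp _ _ (conjLE_rep φ) (conjLE_rep ψ), homMk_rep, homMk_rep]

theorem rep_id (P : Orb 𝓕) : rep (𝟙 P) ∈ P.sub := by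
  have h : ConjLE 1 P.sub P.sub := ConjLE.of_le le_rfl
  have h1 : (𝟙 P : P ⟶ P) = homMk 1 h := hom_ext fun g => by
    rw [toMap_homMk, mul_one]; rfl
  have := rep_homMk 1 h
  rw [← h1] at this
  simpa using this

end Orb

end Orb

/-! ### Functors of fixed elements and atomic functors -/

section FixedFunctor

variable {G : Type u} [Group G] (𝓕 : Set (Subgroup G)) {k : Type*} [CommRing k]
  {N : Type u} [AddCommGroup N] [Module k N] (ρ : Representation k G N)

theorem rep_apply_eq {A : Subgroup G} {n : N} (hn : ∀ a ∈ A, ρ a n = n) {g g' : G}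
    (h : g⁻¹ * g' ∈ A) : ρ g n = ρ g' n := by
  have h1 := congrArg (ρ g) (hn _ h)
  rw [← Module.End.mul_apply, ← map_mul] at h1
  simpa using h1.symm

/-- The functor on an orbit category whose value at `A` is a group `S A` of elements fixed by
`A`, and where `g P ↦ g a Q` acts by `a`. -/
noncomputable def fixedFunctor (S : Subgroup G → AddSubgroup N)
    (hfix : ∀ A ∈ 𝓕, ∀ n ∈ S A, ∀ a ∈ A, ρ a n = n)
    (hmap : ∀ (A B : Subgroup G) (g : G), ConjLE g A B → ∀ n ∈ S B, ρ g n ∈ S A) :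
    (Orb 𝓕)ᵒᵖ ⥤ AddCommGrpCat.{u} where
  obj A := AddCommGrpCat.of (S A.unop.sub)
  map {B A} φ := AddCommGrpCat.ofHom
    (((ρ (Orb.rep φ.unop)).toAddMonoidHom.comp (S B.unop.sub).subtype).codRestrict
      (S A.unop.sub) (fun n => hmap _ _ _ (Orb.conjLE_rep φ.unop) n.1 n.2))
  map_id A := AddCommGrpCat.hom_ext <| AddMonoidHom.ext fun n => Subtype.ext <|
    hfix _ A.unop.mem n.1 n.2 _ (Orb.rep_id A.unop)
  map_comp {R Q P} ψ φ := AddCommGrpCat.hom_ext <| AddMonoidHom.ext fun n => Subtype.ext <| by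
    refine (rep_apply_eq ρ (hfix _ R.unop.mem n.1 n.2) (Orb.rep_comp φ.unop ψ.unop)).trans ?_
    rw [map_mul]
    rfl

/-- The functor on an orbit category that is `N` at the trivial subgroup and `0` elsewhere. -/
noncomputable def orbAtomic : (Orb 𝓕)ᵒᵖ ⥤ AddCommGrpCat.{u} :=
  fixedFunctor 𝓕 ρ (fun A => atomicSubgroup N A)
    (fun A _ n hn a ha => by
      by_cases hA : A = ⊥
      · rw [hA, Subgroup.mem_bot] at ha
        simp [ha]
      · simp [mem_atomicSubgroup.1 hn hA])
    (fun A B g hg n hn => by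
      rw [mem_atomicSubgroup] at hn ⊢
      intro hA
      rw [hn, map_zero]
      rintro rfl
      apply hA
      rw [Subgroup.eq_bot_iff_forall]
      intro x hx
      have := hg x hx
      rw [Subgroup.mem_bot] at this
      have h2 : x = g * (g⁻¹ * x * g) * g⁻¹ := by group
      rw [h2, this]
      simp)

end FixedFunctor

/-! ### Functors between orbit categories induced by group homomorphisms -/

section Induction

variable {G H : Type u} [Group G] [Group H]

/-- Data for a functor from an orbit category of `H` to one of `G` that is given by `j : H →* G`
on representatives and sends `P` to a smallest subgroup containing `j P` and `V`, such that the
points of `G / A` fixed by `V` have stabilizers in the family `𝓗`. -/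
structure OrbInduction (j : H →* G) (V : Subgroup G) (𝓗 : Set (Subgroup H))
    (𝓐 : Set (Subgroup G)) where
  obj : Subgroup H → Subgroup G
  obj_mem : ∀ P ∈ 𝓗, obj P ∈ 𝓐
  conjLE_iff : ∀ P ∈ 𝓗, ∀ A ∈ 𝓐, ∀ g,
    ConjLE g (obj P) A ↔ ConjLE g (P.map j) A ∧ ConjLE g V A
  normalizes : ∀ h, ConjLE (j h) V V
  bot_mem : ⊥ ∈ 𝓗
  stab_mem : ∀ A ∈ 𝓐, ∀ g, ConjLE g V A → ∃ P ∈ 𝓗, ∀ h, h ∈ P ↔ g⁻¹ * j h * g ∈ A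

namespace OrbInduction

variable {j : H →* G} {V : Subgroup G} {𝓗 : Set (Subgroup H)} {𝓐 : Set (Subgroup G)}
  (d : OrbInduction j V 𝓗 𝓐)
include d

theorem le_obj {P : Subgroup H} (hP : P ∈ 𝓗) : P.map j ≤ d.obj P ∧ V ≤ d.obj P := by
  have h := (d.conjLE_iff P hP _ (d.obj_mem P hP) 1).1 (ConjLE.of_le le_rfl)
  exact ⟨fun y hy => by simpa using h.1 y hy, fun y hy => by simpa using h.2 y hy⟩

theorem conjLE_map {P Q : Subgroup H} (hP : P ∈ 𝓗) (hQ : Q ∈ 𝓗) {a : H} (h : ConjLE a P Q) :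
    ConjLE (j a) (d.obj P) (d.obj Q) := by
  rw [d.conjLE_iff P hP _ (d.obj_mem Q hQ)]
  refine ⟨?_, fun v hv => (d.le_obj hQ).2 (d.normalizes a v hv)⟩
  rintro _ ⟨y, hy, rfl⟩
  apply (d.le_obj hQ).1
  exact ⟨_, h y hy, by simp⟩

theorem conjLE_mul_left {A : Subgroup G} {g : G} (h : H) (hg : ConjLE g V A) :
    ConjLE (j h * g) V A :=
  (d.normalizes h).comp hg

theorem conjLE_mul_left_iff {A : Subgroup G} {g : G} (h : H) :
    ConjLE (j h * g) V A ↔ ConjLE g V A :=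
  ⟨fun hg => by simpa [← mul_assoc, ← map_mul] using d.conjLE_mul_left h⁻¹ hg,
    d.conjLE_mul_left h⟩

/-- The functor between orbit categories. -/
noncomputable def functor : Orb 𝓗 ⥤ Orb 𝓐 where
  obj P := ⟨d.obj P.sub, d.obj_mem _ P.mem⟩
  map {P Q} φ := Orb.homMk (j (Orb.rep φ)) (d.conjLE_map P.mem Q.mem (Orb.conjLE_rep φ))
  map_id P := by
    have h := (d.le_obj P.mem).1 ⟨_, Orb.rep_id P, rfl⟩
    rw [← Orb.homMk_rep (𝟙 (⟨d.obj P.sub, d.obj_mem _ P.mem⟩ : Orb 𝓐)), Orb.homMk_eq_iff]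
    exact Subgroup.mul_mem _ (Subgroup.inv_mem _ h) (Orb.rep_id _)
  map_comp {P Q R} φ ψ := by
    rw [Orb.homMk_comp, Orb.homMk_eq_iff]
    refine (d.le_obj R.mem).1 ⟨_, Orb.rep_comp φ ψ, by simp⟩

theorem functor_map_comp_eq_iff {P Q : Orb 𝓗} {A : Orb 𝓐} (u : P ⟶ Q) (g : G)
    (hg : ConjLE g (d.functor.obj Q).sub A.sub) (f : d.functor.obj P ⟶ A) :
    d.functor.map u ≫ Orb.homMk g hg = f ↔ (j (Orb.rep u) * g)⁻¹ * Orb.rep f ∈ A.sub := by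
  have h1 : d.functor.map u ≫ Orb.homMk g hg = Orb.homMk (j (Orb.rep u) * g) _ :=
    Orb.homMk_comp (P := d.functor.obj P) (Q := d.functor.obj Q) _ g
      (d.conjLE_map P.mem Q.mem (Orb.conjLE_rep u)) hg
  rw [h1]
  conv_lhs => rw [← Orb.homMk_rep f]
  exact Orb.homMk_eq_iff _ _

theorem map_rep_homMk_mem {P Q : Orb 𝓗} (a : H) (h : ConjLE a P.sub Q.sub) :
    (j (Orb.rep (Orb.homMk a h)))⁻¹ * j a ∈ d.obj Q.sub :=
  (d.le_obj Q.mem).1 ⟨_, Orb.rep_homMk a h, by simp⟩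

/-- A morphism from the image of `Q` to `A` is a point `g A` fixed by `V` and `j Q`. The group `H`
permutes the `V`-fixed points; choose one point in each orbit and let `t` be its stabilizer. An
element `h` moving the chosen point to `g A` gives the factorization, and it is unique up to that
stabilizer. -/
theorem isMultiLeftAdjoint : IsMultiLeftAdjoint d.functor := by
  intro A
  let r : Setoid {g : G // ConjLE g V A.sub} :=
    { r := fun g g' => ∃ h : H, (j h * g.1)⁻¹ * g'.1 ∈ A.sub
      iseqv :=
        { refl := fun g => ⟨1, by simp⟩
          symm := fun {g g'} ⟨h, hh⟩ => ⟨h⁻¹, by simpa [mul_assoc] using A.sub.inv_mem hh⟩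
          trans := fun {g g' g''} ⟨h, hh⟩ ⟨h', hh'⟩ => ⟨h' * h, by
            simpa [mul_assoc] using A.sub.mul_mem hh hh'⟩ } }
  choose P hP hPs using fun g : {g : G // ConjLE g V A.sub} => d.stab_mem A.sub A.mem g.1 g.2
  have hε : ∀ q : Quotient r, ConjLE q.out.1 (d.obj (P q.out)) A.sub := fun q => by
    rw [d.conjLE_iff _ (hP _) _ A.mem]
    refine ⟨?_, q.out.2⟩
    rintro _ ⟨y, hy, rfl⟩
    exact (hPs _ _).1 hy
  refine ⟨Quotient r, fun q => ⟨P q.out, hP q.out⟩, fun q => Orb.homMk q.out.1 (hε q), ?_⟩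
  intro Q f
  have hf := (d.conjLE_iff _ Q.mem _ A.mem _).1 (Orb.conjLE_rep f)
  let g : {g : G // ConjLE g V A.sub} := ⟨Orb.rep f, hf.2⟩
  let q : Quotient r := Quotient.mk r g
  obtain ⟨h, hh⟩ := Quotient.exact (s := r) (q.out_eq)
  have hc : ConjLE h Q.sub (P q.out) := fun y hy => by
    rw [hPs]
    have h1 : ConjLE (j h * q.out.1) (Q.sub.map j) A.sub := (ConjLE.congr_iff hh).2 hf.1
    have h2 := h1 _ ⟨y, hy, rfl⟩
    simpa [mul_assoc] using h2
  refine ⟨⟨q, Orb.homMk h hc⟩, ?_, ?_⟩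
  · refine (d.functor_map_comp_eq_iff _ _ (hε q) f).2 ?_
    have h1 := d.map_rep_homMk_mem (Q := ⟨P q.out, hP q.out⟩) h hc
    have h2 := hε q _ h1
    have h3 := A.sub.mul_mem h2 hh
    simpa [mul_assoc] using h3
  · rintro ⟨q', u⟩ hu
    have hu := (d.functor_map_comp_eq_iff u _ (hε q') f).1 hu
    obtain rfl : q' = q := by
      rw [← q'.out_eq]
      exact Quotient.sound (s := r) ⟨_, hu⟩
    congr 1
    rw [← Orb.homMk_rep u, Orb.homMk_eq_iff, hPs]
    have h3 : _ * ((j h * q.out.1)⁻¹ * Orb.rep f)⁻¹ ∈ A.sub := A.sub.mul_mem hu (A.sub.inv_mem hh)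
    simpa [mul_assoc] using h3

end OrbInduction

end Induction

/-! ### Kan extensions of atomic functors as equivariant functions -/

section FunModel

variable {G H : Type u} [Group G] [Group H] {k : Type*} [CommRing k]
  {M : Type u} [AddCommGroup M] [Module k M]

/-- The `H`-equivariant functions `G → M` that are invariant under right translation by `A`,
supported on the points of `G / A` that are fixed by `V` and have a trivial stabilizer in `H`. -/
def equivariantFun (j : H →* G) (V : Subgroup G) (ρ : Representation k H M) (A : Subgroup G) :
    AddSubgroup (G → M) where
  carrier := {s | (∀ g, ∀ a ∈ A, s (g * a) = s g) ∧ (∀ h g, s (j h * g) = ρ h (s g)) ∧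
    (∀ g, ¬ ConjLE g V A → s g = 0) ∧ ∀ g h, h ≠ 1 → g⁻¹ * j h * g ∈ A → s g = 0}
  zero_mem' := ⟨fun _ _ _ => rfl, fun _ _ => (map_zero _).symm, fun _ _ => rfl,
    fun _ _ _ _ => rfl⟩
  add_mem' := fun {s t} hs ht => ⟨fun g a ha => by simp [hs.1 g a ha, ht.1 g a ha],
    fun h g => by simp [hs.2.1, ht.2.1],
    fun g hg => by simp [hs.2.2.1 g hg, ht.2.2.1 g hg],
    fun g h hh hg => by simp [hs.2.2.2 g h hh hg, ht.2.2.2 g h hh hg]⟩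
  neg_mem' := fun {s} hs => ⟨fun g a ha => by simp [hs.1 g a ha],
    fun h g => by simp [hs.2.1],
    fun g hg => by simp [hs.2.2.1 g hg],
    fun g h hh hg => by simp [hs.2.2.2 g h hh hg]⟩

namespace OrbInduction

variable {j : H →* G} {V : Subgroup G} {𝓗 : Set (Subgroup H)} {𝓐 : Set (Subgroup G)}
  (d : OrbInduction j V 𝓗 𝓐) (ρ : Representation k H M)

/-- The trivial subgroup as an object of the orbit category. -/
abbrev botObj : Orb 𝓗 := ⟨⊥, d.bot_mem⟩

theorem conjLE_obj_bot {A : Orb 𝓐} {g : G} (hg : ConjLE g V A.sub) :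
    ConjLE g (d.functor.obj d.botObj).sub A.sub :=
  (d.conjLE_iff ⊥ d.bot_mem _ A.mem g).2 ⟨by
    rintro _ ⟨y, hy, rfl⟩
    rw [SetLike.mem_coe, Subgroup.mem_bot] at hy
    simp [hy], hg⟩

open Classical in
/-- The restriction of `M`-valued functions along a morphism of the orbit category. -/
noncomputable def equivariantFunMap {A B : Orb 𝓐} (φ : A ⟶ B) :
    equivariantFun j V ρ B.sub →+ equivariantFun j V ρ A.sub :=
  AddMonoidHom.mk' (fun s => ⟨fun g => if ConjLE g V A.sub then s.1 (g * Orb.rep φ) else 0, by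
    refine ⟨fun g a ha => ?_, fun h g => ?_, fun g hg => if_neg hg, fun g h hh hg => ?_⟩
    · have h1 : ConjLE (g * a) V A.sub ↔ ConjLE g V A.sub :=
        (ConjLE.congr_iff (by simpa using ha)).symm
      beta_reduce
      simp only [h1]
      have h2 := s.2.1 (g * Orb.rep φ) _ (Orb.conjLE_rep φ a ha)
      rw [← h2]
      simp [mul_assoc]
    · beta_reduce
      simp only [d.conjLE_mul_left_iff, mul_assoc, s.2.2.1]
      split_ifs <;> simp
    · beta_reduce
      split_ifs
      · refine s.2.2.2.2 _ h hh ?_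
        have := Orb.conjLE_rep φ _ hg
        simpa [mul_assoc] using this
      · rfl⟩) (fun s t => Subtype.ext (funext fun g => by
        change (if _ then s.1 _ + t.1 _ else 0) = (if _ then s.1 _ else 0) + (if _ then t.1 _ else 0)
        split_ifs <;> simp))

open Classical in
theorem equivariantFunMap_apply {A B : Orb 𝓐} (φ : A ⟶ B) (s : equivariantFun j V ρ B.sub)
    (g : G) : (d.equivariantFunMap ρ φ s).1 g =
      if ConjLE g V A.sub then s.1 (g * Orb.rep φ) else 0 := rfl

/-- The functor of equivariant functions on `G / A`. -/
noncomputable def funFunctor : (Orb 𝓐)ᵒᵖ ⥤ AddCommGrpCat.{u} where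
  obj A := AddCommGrpCat.of (equivariantFun j V ρ A.unop.sub)
  map {B A} φ := AddCommGrpCat.ofHom (d.equivariantFunMap ρ φ.unop)
  map_id A := AddCommGrpCat.hom_ext <| AddMonoidHom.ext fun s => Subtype.ext <| funext fun g => by
    change (d.equivariantFunMap ρ (𝟙 A.unop) s).1 g = s.1 g
    rw [equivariantFunMap_apply]
    split_ifs with hg
    · exact s.2.1 g _ (Orb.rep_id _)
    · exact (s.2.2.2.1 g hg).symm
  map_comp {R Q P} ψ φ := AddCommGrpCat.hom_ext <| AddMonoidHom.ext fun s => Subtype.ext <|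
    funext fun g => by
    change (d.equivariantFunMap ρ (φ.unop ≫ ψ.unop) s).1 g =
      (d.equivariantFunMap ρ φ.unop (d.equivariantFunMap ρ ψ.unop s)).1 g
    rw [equivariantFunMap_apply, equivariantFunMap_apply]
    split_ifs with hg
    · rw [equivariantFunMap_apply, if_pos (hg.comp (Orb.conjLE_rep φ.unop))]
      have h2 := s.2.1 (g * Orb.rep (φ.unop ≫ ψ.unop)) _ (Orb.rep_comp φ.unop ψ.unop)
      rw [← h2]
      simp [mul_assoc]
    · rfl

/-- The value of a compatible family at the trivial subgroup. -/
noncomputable def famApply {A : Orb 𝓐}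
    (s : coindSubgroup d.functor (orbAtomic 𝓗 ρ) A) (P : Orb 𝓗) (f : d.functor.obj P ⟶ A) : M :=
  (s.1 P f : atomicSubgroup M P.sub).1

theorem famApply_comp {A : Orb 𝓐} (s : coindSubgroup d.functor (orbAtomic 𝓗 ρ) A)
    {P Q : Orb 𝓗} (v : P ⟶ Q) (f : d.functor.obj Q ⟶ A) :
    d.famApply ρ s P (d.functor.map v ≫ f) = ρ (Orb.rep v) (d.famApply ρ s Q f) :=
  congrArg Subtype.val (s.2 P Q v f)

theorem famApply_eq_zero {A : Orb 𝓐} (s : coindSubgroup d.functor (orbAtomic 𝓗 ρ) A)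
    {P : Orb 𝓗} (f : d.functor.obj P ⟶ A) (hP : P.sub ≠ ⊥) : d.famApply ρ s P f = 0 :=
  mem_atomicSubgroup.1 (s.1 P f : atomicSubgroup M P.sub).2 hP

theorem rep_mul_mem {A : Orb 𝓐} {P Q : Orb 𝓗} (v : P ⟶ Q) (f : d.functor.obj Q ⟶ A) :
    (Orb.rep (d.functor.map v ≫ f))⁻¹ * (j (Orb.rep v) * Orb.rep f) ∈ A.sub := by
  have h := (d.functor_map_comp_eq_iff v _ (Orb.conjLE_rep f) (d.functor.map v ≫ f)).1
    (by rw [Orb.homMk_rep])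
  simpa using A.sub.inv_mem h

open Classical in
/-- The equivariant function defined by a compatible family. -/
noncomputable def famToFun (A : Orb 𝓐) :
    coindSubgroup d.functor (orbAtomic 𝓗 ρ) A →+ equivariantFun j V ρ A.sub :=
  AddMonoidHom.mk' (fun s => ⟨fun g => if hg : ConjLE g V A.sub then
      d.famApply ρ s d.botObj (Orb.homMk g (d.conjLE_obj_bot hg)) else 0, by
    refine ⟨fun g a ha => ?_, fun h g => ?_, fun g hg => dif_neg hg, fun g h hh hg => ?_⟩
    · have h1 : ConjLE (g * a) V A.sub ↔ ConjLE g V A.sub :=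
        (ConjLE.congr_iff (by simpa using ha)).symm
      beta_reduce
      by_cases hg : ConjLE g V A.sub
      · rw [dif_pos hg, dif_pos (h1.2 hg)]
        congr 1
        rw [Orb.homMk_eq_iff]
        simpa using ha
      · rw [dif_neg hg, dif_neg (fun h => hg (h1.1 h))]
    · beta_reduce
      by_cases hg : ConjLE g V A.sub
      · rw [dif_pos hg, dif_pos (d.conjLE_mul_left h hg)]
        have hb : ConjLE h (⊥ : Subgroup H) ⊥ := fun y hy => by
          rw [Subgroup.mem_bot] at hy ⊢
          simp [hy]
        let v : d.botObj ⟶ d.botObj := Orb.homMk h hb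
        have hv : Orb.rep v = h := by
          have := Orb.rep_homMk (P := d.botObj) (Q := d.botObj) h hb
          rw [Subgroup.mem_bot] at this
          exact inv_mul_eq_one.1 this
        have h2 := d.famApply_comp ρ s v (Orb.homMk g (d.conjLE_obj_bot hg))
        rw [hv] at h2
        rw [← h2]
        congr 1
        symm
        rw [functor_map_comp_eq_iff, hv]
        simpa using A.sub.inv_mem (Orb.rep_homMk (P := d.functor.obj d.botObj) (j h * g)
          (d.conjLE_obj_bot (d.conjLE_mul_left h hg)))
      · rw [dif_neg hg, dif_neg (fun h1 => hg ((d.conjLE_mul_left_iff h).1 h1)), map_zero]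
    · beta_reduce
      split_ifs with hV
      -- If the stabilizer `P` of `g A` is nontrivial, the morphism from the trivial object factors
      -- through the object `P`, where the atomic functor is zero.
      · obtain ⟨P, hP, hPs⟩ := d.stab_mem _ A.mem g hV
        have hPA : ConjLE g (d.functor.obj ⟨P, hP⟩).sub A.sub := by
          refine (d.conjLE_iff P hP _ A.mem g).2 ⟨?_, hV⟩
          rintro _ ⟨y, hy, rfl⟩
          exact (hPs y).1 hy
        let v : d.botObj ⟶ ⟨P, hP⟩ := Orb.homMk 1 (ConjLE.of_le bot_le)
        have h2 := d.famApply_comp ρ s v (Orb.homMk g hPA)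
        have hPb : P ≠ ⊥ := by
          rintro rfl
          exact hh (Subgroup.mem_bot.1 ((hPs h).2 hg))
        rw [d.famApply_eq_zero ρ s (P := ⟨P, hP⟩) _ hPb, map_zero] at h2
        rw [← h2]
        congr 1
        symm
        rw [functor_map_comp_eq_iff]
        have h3 : (Orb.rep v)⁻¹ * 1 ∈ P := Orb.rep_homMk (P := d.botObj) (Q := ⟨P, hP⟩) 1 _
        have h4 := A.sub.mul_mem ((hPs _).1 h3) (A.sub.inv_mem (Orb.rep_homMk
          (P := d.functor.obj d.botObj) g (d.conjLE_obj_bot hV)))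
        simpa [mul_assoc] using h4
      · rfl⟩) (fun s t => Subtype.ext (funext fun g => by
        change (if h : _ then d.famApply ρ s _ _ + d.famApply ρ t _ _ else 0) =
          (if h : _ then d.famApply ρ s _ _ else 0) + (if h : _ then d.famApply ρ t _ _ else 0)
        split_ifs <;> simp))

open Classical in
theorem famToFun_apply {A : Orb 𝓐} (s : coindSubgroup d.functor (orbAtomic 𝓗 ρ) A) (g : G) :
    (d.famToFun ρ A s).1 g = if hg : ConjLE g V A.sub then
      d.famApply ρ s d.botObj (Orb.homMk g (d.conjLE_obj_bot hg)) else 0 := rfl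

theorem conjLE_rep_bot {A : Orb 𝓐} {P : Orb 𝓗} (f : d.functor.obj P ⟶ A) :
    ConjLE (Orb.rep f) V A.sub :=
  ((d.conjLE_iff P.sub P.mem _ A.mem _).1 (Orb.conjLE_rep f)).2

/-- Only the members at the trivial subgroup can be nonzero, and these are indexed by the `V`-fixed
points of `G / A`. -/
theorem famToFun_injective (A : Orb 𝓐) : Function.Injective (d.famToFun ρ A) := by
  intro s t hst
  refine coindSubgroup_ext fun P f => Subtype.ext ?_
  change d.famApply ρ s P f = d.famApply ρ t P f
  by_cases hP : P.sub = ⊥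
  · obtain rfl : P = d.botObj := by
      cases P
      cases hP
      rfl
    have h := congrArg (fun x => x.1 (Orb.rep f)) hst
    simp only [famToFun_apply, d.conjLE_rep_bot f, dif_pos] at h
    rwa [Orb.homMk_rep] at h
  · rw [famApply_eq_zero _ _ _ _ hP, famApply_eq_zero _ _ _ _ hP]

-- The function `t` prescribes the members at the trivial subgroup. At a nontrivial `P` the point
-- has nontrivial stabilizer, so `t` vanishes there, in agreement with the atomic functor.
open Classical in
theorem famToFun_surjective (A : Orb 𝓐) : Function.Surjective (d.famToFun ρ A) := by
  intro t
  have hmem : ∀ (P : Orb 𝓗) (f : d.functor.obj P ⟶ A), P.sub ≠ ⊥ → t.1 (Orb.rep f) = 0 := by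
    intro P f hP
    obtain ⟨⟨y, hy⟩, hy1⟩ := Subgroup.ne_bot_iff_exists_ne_one.1 hP
    refine t.2.2.2.2 _ y (fun h => hy1 (Subtype.ext h)) ?_
    exact ((d.conjLE_iff P.sub P.mem _ A.mem _).1 (Orb.conjLE_rep f)).1 _ ⟨y, hy, rfl⟩
  refine ⟨⟨fun P f => (⟨t.1 (Orb.rep f), mem_atomicSubgroup.2 (hmem P f)⟩ :
    atomicSubgroup M P.sub), ?_⟩, ?_⟩
  · intro P Q v f
    refine Subtype.ext ?_
    change t.1 (Orb.rep (d.functor.map v ≫ f)) = ρ (Orb.rep v) (t.1 (Orb.rep f))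
    rw [← t.2.2.1, ← t.2.1 _ _ (d.rep_mul_mem v f)]
    simp
  · refine Subtype.ext (funext fun g => ?_)
    rw [famToFun_apply]
    split_ifs with hg
    · change t.1 (Orb.rep (Orb.homMk g (d.conjLE_obj_bot hg))) = t.1 g
      rw [← t.2.1 _ _ (Orb.rep_homMk (P := d.functor.obj d.botObj) g (d.conjLE_obj_bot hg))]
      simp
    · exact (t.2.2.2.1 g hg).symm

/-- The right Kan extension of an atomic functor consists of equivariant functions. -/
noncomputable def coindIsoFun : (coind d.functor).obj (orbAtomic 𝓗 ρ) ≅ d.funFunctor ρ :=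
  NatIso.ofComponents (fun A => (AddEquiv.ofBijective (d.famToFun ρ A.unop)
    ⟨d.famToFun_injective ρ _, d.famToFun_surjective ρ _⟩).toAddCommGrpIso) (by
    intro B A φ
    refine AddCommGrpCat.hom_ext <| AddMonoidHom.ext fun s => Subtype.ext <| funext fun g => ?_
    let s₁ : coindSubgroup d.functor (orbAtomic 𝓗 ρ) B.unop := s
    let s₂ : coindSubgroup d.functor (orbAtomic 𝓗 ρ) A.unop :=
      (((coind d.functor).obj (orbAtomic 𝓗 ρ)).map φ).hom s
    change (d.famToFun ρ A.unop s₂).1 g =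
      (d.equivariantFunMap ρ φ.unop (d.famToFun ρ B.unop s₁)).1 g
    rw [equivariantFunMap_apply, famToFun_apply, famToFun_apply]
    split_ifs with h1 h2
    · change d.famApply ρ s₁ d.botObj (Orb.homMk g (d.conjLE_obj_bot h1) ≫ φ.unop) = _
      congr 1
      conv_lhs => rw [← Orb.homMk_rep φ.unop]
      exact Orb.homMk_comp (P := d.functor.obj d.botObj) _ _ _ _
    · exact absurd (h1.comp (Orb.conjLE_rep φ.unop)) h2
    · rfl)

/-- The higher limits of an atomic functor agree with those of the functor of equivariant
functions. -/
theorem higherLimit_funFunctor_iso (i : ℕ) :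
    Nonempty (higherLimit i (d.funFunctor ρ) ≅ higherLimit i (orbAtomic 𝓗 ρ)) := by
  obtain ⟨e⟩ := d.isMultiLeftAdjoint.higherLimit_coind_iso i (orbAtomic 𝓗 ρ)
  exact ⟨higherLimitIso i (d.coindIsoFun ρ).symm ≪≫ e⟩

end OrbInduction

end FunModel

/-! ### Families of `p`-subgroups of a product of groups -/

section Families

theorem isPGroup_iff_forall_mem {p : ℕ} {G : Type*} [Group G] {P : Subgroup G} :
    IsPGroup p P ↔ ∀ x ∈ P, ∃ n : ℕ, x ^ p ^ n = 1 := by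
  simp [IsPGroup, Subtype.ext_iff]

theorem isPGroup_prod {p : ℕ} {G H : Type*} [Group G] [Group H] {P : Subgroup G} {Q : Subgroup H} (hP : IsPGroup p P)
    (hQ : IsPGroup p Q) : IsPGroup p (P.prod Q) := by
  rw [isPGroup_iff_forall_mem] at *
  rintro ⟨x, y⟩ ⟨hx, hy⟩
  obtain ⟨m, hm⟩ := hP x hx
  obtain ⟨n, hn⟩ := hQ y hy
  refine ⟨m + n, Prod.ext ?_ ?_⟩
  · simp only [Prod.pow_mk, Prod.fst_one]
    rw [pow_add, pow_mul, hm, one_pow]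
  · simp only [Prod.pow_mk, Prod.snd_one]
    rw [add_comm, pow_add, pow_mul, hn, one_pow]

variable {G H : Type u} [Group G] [Group H]

/-- The `p`-subgroups of `G`. -/
def pSubgroups (p : ℕ) (G : Type u) [Group G] : Set (Subgroup G) := {P | IsPGroup p P}

/-- The subgroup of all `h` such that `j h` fixes the point `g A` of `G / A`. -/
def pointStabilizer (j : H →* G) (g : G) (A : Subgroup G) : Subgroup H :=
  (A.comap (MulAut.conj g⁻¹).toMonoidHom).comap j

theorem mem_pointStabilizer {j : H →* G} {g : G} {A : Subgroup G} {h : H} :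
    h ∈ pointStabilizer j g A ↔ g⁻¹ * j h * g ∈ A := by
  simp [pointStabilizer]

theorem isPGroup_pointStabilizer {p : ℕ} {j : H →* G} (hj : Function.Injective j) (g : G)
    {A : Subgroup G} (hA : IsPGroup p A) : IsPGroup p (pointStabilizer j g A) :=
  (hA.comap_of_injective _ (MulAut.conj g⁻¹).injective).comap_of_injective _ hj

theorem conjLE_bot (g : G) (A : Subgroup G) : ConjLE g ⊥ A := fun y hy => by
  rw [Subgroup.mem_bot] at hy
  simp [hy]

theorem conjLE_map_id {g : G} {P A : Subgroup G} :
    ConjLE g (P.map (MonoidHom.id G)) A ↔ ConjLE g P A := by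
  rw [Subgroup.map_id]

/-- The `p`-subgroups of `G × H` that are products of a subgroup of `G` and one of `H`. -/
def prodSubgroups (p : ℕ) (G H : Type u) [Group G] [Group H] : Set (Subgroup (G × H)) :=
  {P | IsPGroup p P ∧ ∀ x ∈ P, (x.1, 1) ∈ P}

theorem snd_mem_of_mem_prodSubgroups {p : ℕ} {P : Subgroup (G × H)}
    (hP : P ∈ prodSubgroups p G H) {x : G × H} (hx : x ∈ P) : (1, x.2) ∈ P := by
  have := P.mul_mem (P.inv_mem (hP.2 x hx)) hx
  convert this using 1
  ext <;> simp

theorem bot_mem_prodSubgroups (p : ℕ) : ⊥ ∈ prodSubgroups p G H :=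
  ⟨IsPGroup.of_bot, fun x hx => by
    rw [Subgroup.mem_bot] at hx ⊢
    simp [hx]⟩

theorem bot_mem_pSubgroups (p : ℕ) : ⊥ ∈ pSubgroups p G := IsPGroup.of_bot

/-- Passage from a `p`-subgroup of `G × H` to the product of its projections. -/
def orbInductionProdHull (p : ℕ) (G H : Type u) [Group G] [Group H] :
    OrbInduction (MonoidHom.id (G × H)) ⊥ (pSubgroups p (G × H)) (prodSubgroups p G H) where
  obj P := (P.map (MonoidHom.fst G H)).prod (P.map (MonoidHom.snd G H))
  obj_mem P hP := ⟨isPGroup_prod (IsPGroup.map hP _) (IsPGroup.map hP _),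
    fun x hx => ⟨hx.1, Subgroup.one_mem _⟩⟩
  conjLE_iff P _ A hA g := by
    rw [conjLE_map_id]
    refine ⟨fun h => ⟨fun y hy => h y ⟨⟨y, hy, rfl⟩, ⟨y, hy, rfl⟩⟩, conjLE_bot g A⟩, ?_⟩
    rintro ⟨h, -⟩ ⟨_, _⟩ ⟨⟨x, hx, rfl⟩, ⟨y, hy, rfl⟩⟩
    have h1 := A.mul_mem (hA.2 _ (h x hx)) (snd_mem_of_mem_prodSubgroups hA (h y hy))
    convert h1 using 1
    ext <;> simp
  normalizes _ := conjLE_bot _ _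
  bot_mem := bot_mem_pSubgroups p
  stab_mem A hA g _ := ⟨pointStabilizer _ g A,
    isPGroup_pointStabilizer Function.injective_id g hA.1, fun _ => mem_pointStabilizer⟩

/-- Passage from a product `P₁ × P₂` to `P₁ × H`, where `H` is a `p`-group. -/
def orbInductionProdTop (p : ℕ) (G H : Type u) [Group G] [Group H]
    (hH : IsPGroup p (⊤ : Subgroup H)) :
    OrbInduction (MonoidHom.id (G × H)) ⊥ (prodSubgroups p G H)
      {P | P ∈ prodSubgroups p G H ∧ ∀ h : H, (1, h) ∈ P} where
  obj P := (P.map (MonoidHom.fst G H)).prod ⊤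
  obj_mem P hP := ⟨⟨isPGroup_prod (IsPGroup.map hP.1 _) hH,
    fun x hx => ⟨hx.1, Subgroup.one_mem _⟩⟩,
    fun h => ⟨Subgroup.one_mem _, Subgroup.mem_top _⟩⟩
  conjLE_iff P _ A hA g := by
    rw [conjLE_map_id]
    refine ⟨fun h => ⟨fun y hy => h y ⟨⟨y, hy, rfl⟩, Subgroup.mem_top _⟩, conjLE_bot g A⟩, ?_⟩
    rintro ⟨h, -⟩ ⟨_, y⟩ ⟨⟨x, hx, rfl⟩, -⟩
    have h1 := A.mul_mem (hA.1.2 _ (h x hx)) (hA.2 (g.2⁻¹ * y * g.2))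
    convert h1 using 1
    ext <;> simp
  normalizes _ := conjLE_bot _ _
  bot_mem := bot_mem_prodSubgroups p
  stab_mem A hA g _ := by
    refine ⟨pointStabilizer _ g A,
      ⟨isPGroup_pointStabilizer Function.injective_id g hA.1.1, fun x hx => ?_⟩,
      fun _ => mem_pointStabilizer⟩
    rw [mem_pointStabilizer] at hx ⊢
    have := hA.1.2 _ hx
    convert this using 1
    ext <;> simp

/-- The functor induced by the inclusion of `G × Q` into `G × H`. -/
def orbInductionProdSubgroup (p : ℕ) (G : Type u) {H : Type u} [Group G] [Group H]
    (Q : Subgroup H) :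
    OrbInduction ((MonoidHom.id G).prodMap Q.subtype) ⊥ (prodSubgroups p G Q)
      (prodSubgroups p G H) where
  obj P := P.map ((MonoidHom.id G).prodMap Q.subtype)
  obj_mem _ hP := ⟨IsPGroup.map hP.1 _, by
    rintro _ ⟨x, hx, rfl⟩
    exact ⟨_, hP.2 x hx, rfl⟩⟩
  conjLE_iff _ _ A _ g := ⟨fun h => ⟨h, conjLE_bot g A⟩, fun h => h.1⟩
  normalizes _ := conjLE_bot _ _
  bot_mem := bot_mem_prodSubgroups p
  stab_mem A hA g _ := by
    refine ⟨pointStabilizer _ g A,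
      ⟨isPGroup_pointStabilizer (Function.injective_id.prodMap Q.subtype_injective) g hA.1,
        fun x hx => ?_⟩, fun _ => mem_pointStabilizer⟩
    rw [mem_pointStabilizer] at hx ⊢
    have := hA.2 _ hx
    convert this using 1
    ext <;> simp

end Families

/-! ### Vanishing when a factor with order divisible by `p` acts trivially -/

section Vanishing

variable {p : ℕ} {G H : Type u} [Group G] [Group H] {k : Type*} [CommRing k]
  {M : Type u} [AddCommGroup M] [Module k M]

theorem AddCommGrpCat.isZero_of_forall_eq_zero {A : AddCommGrpCat.{u}} (h : ∀ a : A, a = 0) :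
    IsZero A :=
  have : Subsingleton A := ⟨fun a b => (h a).trans (h b).symm⟩
  AddCommGrpCat.isZero_of_subsingleton A

theorem isZero_higherLimit_of_isZero {C : Type u} [SmallCategory C]
    {F : Cᵒᵖ ⥤ AddCommGrpCat.{u}} (h : ∀ c, IsZero (F.obj c)) (i : ℕ) :
    IsZero (higherLimit i F) := by
  have hF : IsZero F := Functor.isZero F h
  cases i with
  | zero =>
    exact IsZero.of_iso (Functor.map_isZero lim hF) (higherLimitZeroIso F)
  | succ n =>
    have : Injective F := hF.injective
    exact Functor.isZero_rightDerived_obj_injective_succ _ n F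

/-- The higher limits of an atomic functor over the products in `G × H` vanish if `H` is a
nontrivial `p`-group. -/
theorem isZero_higherLimit_orbAtomic_of_isPGroup [Nontrivial H]
    (hH : IsPGroup p (⊤ : Subgroup H)) (ρ : Representation k (G × H) M) (i : ℕ) :
    IsZero (higherLimit i (orbAtomic (prodSubgroups p G H) ρ)) := by
  obtain ⟨e⟩ := (orbInductionProdTop p G H hH).higherLimit_funFunctor_iso ρ i
  refine IsZero.of_iso (isZero_higherLimit_of_isZero (fun A => ?_) i) e.symm
  refine AddCommGrpCat.isZero_of_forall_eq_zero fun s => ?_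
  -- Every `A` in the target family contains `1 × H`, so no point of the orbit has a trivial
  -- stabilizer and all values of the extension are zero.
  obtain ⟨q, hq⟩ := exists_ne (1 : H)
  refine Subtype.ext (funext fun g => ?_)
  refine s.2.2.2.2 g (1, q) (by simpa [Prod.ext_iff] using hq) ?_
  have := A.unop.mem.2 (g.2⁻¹ * q * g.2)
  convert this using 1
  ext <;> simp

/-- A function that is invariant under the action of a `p`-group and that vanishes at the fixed
points has sum zero in a module of exponent `p`. -/
theorem sum_eq_zero_of_isPGroup [Fact p.Prime] {P X : Type*} [Group P] (hP : IsPGroup p P)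
    [MulAction P X] [Fintype X] (hM : ∀ m : M, p • m = 0) (f : X → M)
    (hf : ∀ (b : P) x, f (b • x) = f x) (h0 : ∀ x, (∀ b : P, b • x = x) → f x = 0) :
    ∑ x, f x = 0 := by
  classical
  rw [← Finset.sum_fiberwise_of_maps_to (s := Finset.univ) (t := Finset.univ.image f) (g := f)
    (fun x _ => Finset.mem_image_of_mem f (Finset.mem_univ x))]
  refine Finset.sum_eq_zero fun m _ => ?_
  rw [Finset.sum_congr rfl (fun x hx => (Finset.mem_filter.1 hx).2), Finset.sum_const]
  by_cases hm : m = 0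
  · rw [hm, smul_zero]
  -- The fibre over `m ≠ 0` is `P`-stable without fixed points, so `p` divides its size.
  let Y : SubMulAction P X := ⟨{x | f x = m}, fun b {x} hx => (hf b x).trans hx⟩
  have hY := hP.card_modEq_card_fixedPoints Y
  have hfix : IsEmpty (MulAction.fixedPoints P Y) := ⟨fun y => hm <| by
    rw [← y.1.2]
    exact h0 _ fun b => congrArg Subtype.val (y.2 b)⟩
  rw [Nat.card_eq_zero.2 (Or.inl hfix)] at hY
  have hcard : Nat.card Y = (Finset.univ.filter fun x => f x = m).card := by
    rw [← Nat.card_eq_finsetCard]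
    exact Nat.card_congr (Equiv.subtypeEquivRight fun x => by
      rw [Finset.mem_filter_univ]
      exact Iff.rfl)
  obtain ⟨c, hc⟩ := Nat.modEq_zero_iff_dvd.1 hY
  rw [← hcard, hc, mul_comm, mul_smul, hM, smul_zero]

section Transfer

variable (Q : Subgroup H) (ρ : Representation k (G × H) M)

/-- The restriction of a representation of `G × H` to `G × Q`. -/
abbrev resRep : Representation k (G × Q) M := ρ.comp ((MonoidHom.id G).prodMap Q.subtype)

/-- The function `g ↦ g n`. -/
noncomputable def orbitMap (A : Subgroup (G × H)) : atomicSubgroup M A →+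
    equivariantFun ((MonoidHom.id G).prodMap Q.subtype) ⊥ (resRep Q ρ) A :=
  AddMonoidHom.mk' (fun n => ⟨fun g => ρ g n.1, by
      refine ⟨fun g a ha => ?_, fun h g => ?_, fun g hg => absurd (conjLE_bot g _) hg,
        fun g h hh hg => ?_⟩
      · by_cases hA : A = ⊥
        · rw [hA, Subgroup.mem_bot] at ha
          rw [ha, mul_one]
        · simp [mem_atomicSubgroup.1 n.2 hA]
      · simp
      · beta_reduce
        rw [mem_atomicSubgroup.1 n.2, map_zero]
        intro hA
        rw [hA, Subgroup.mem_bot] at hg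
        apply hh
        have h1 : (MonoidHom.id G).prodMap Q.subtype h = (MonoidHom.id G).prodMap Q.subtype 1 := by
          have h2 := congrArg (fun x => g * x * g⁻¹) hg
          rw [map_one]
          simpa [mul_assoc] using h2
        exact (Function.injective_id.prodMap Q.subtype_injective) h1⟩)
    (fun a b => Subtype.ext (funext fun g => map_add (ρ g) a.1 b.1))

theorem orbitMap_apply {A : Subgroup (G × H)} (n : atomicSubgroup M A) (g : G × H) :
    (orbitMap Q ρ A n).1 g = ρ g n.1 := rfl

variable (p) in
/-- The map from an atomic functor to the functor induced from its restriction to `G × Q`. -/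
noncomputable def restrictionHom : orbAtomic (prodSubgroups p G H) ρ ⟶
    (orbInductionProdSubgroup p G Q).funFunctor (resRep Q ρ) where
  app A := AddCommGrpCat.ofHom (orbitMap Q ρ A.unop.sub)
  naturality B A φ := by
    refine AddCommGrpCat.hom_ext <| AddMonoidHom.ext fun n => Subtype.ext <| funext fun g => ?_
    let n' : atomicSubgroup M B.unop.sub := n
    change ρ g (ρ (Orb.rep φ.unop) n'.1) =
      ((orbInductionProdSubgroup p G Q).equivariantFunMap (resRep Q ρ) φ.unop
        (orbitMap Q ρ B.unop.sub n')).1 g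
    rw [OrbInduction.equivariantFunMap_apply, if_pos (conjLE_bot g _), orbitMap_apply, map_mul]
    rfl

variable {Q ρ}

/-- Because `H` acts trivially on `M`, equivariance under `1 × Q` becomes invariance under left
translation by `Q`. The inverses turn this into a function on the left cosets `H / Q`, over which
the transfer sums. -/
theorem transfer_eq (hρ : ∀ h, ρ (1, h) = 1) {A : Subgroup (G × H)}
    (s : equivariantFun ((MonoidHom.id G).prodMap Q.subtype) ⊥ (resRep Q ρ) A)
    (g : G) (x y : H) (hxy : (x : H ⧸ Q) = y) : s.1 (g, x⁻¹) = s.1 (g, y⁻¹) := by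
  rw [QuotientGroup.eq] at hxy
  have h := s.2.2.1 (1, ⟨x⁻¹ * y, hxy⟩) (g, y⁻¹)
  have h1 : ((MonoidHom.id G).prodMap Q.subtype) (1, ⟨x⁻¹ * y, hxy⟩) * (g, y⁻¹) = (g, x⁻¹) := by
    ext <;> simp
  have h2 : resRep Q ρ (1, ⟨x⁻¹ * y, hxy⟩) = 1 := hρ _
  rw [h1, h2] at h
  exact h

/-- The value of an equivariant function on `G × H` at a point of `H / Q`. -/
noncomputable def cosetApply {A : Subgroup (G × H)}
    (s : equivariantFun ((MonoidHom.id G).prodMap Q.subtype) ⊥ (resRep Q ρ) A) (g : G)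
    (y : H ⧸ Q) : M := s.1 (g, y.out⁻¹)

theorem cosetApply_mk (hρ : ∀ h, ρ (1, h) = 1) {A : Subgroup (G × H)}
    (s : equivariantFun ((MonoidHom.id G).prodMap Q.subtype) ⊥ (resRep Q ρ) A) (g : G) (x : H) :
    cosetApply s g (x : H ⧸ Q) = s.1 (g, x⁻¹) :=
  transfer_eq hρ s g _ _ (QuotientGroup.out_eq' _)

/-- This makes the transfer land in the atomic functor. Restricting to product subgroups matters:
both components of an element of `A` lie in `A`, so one of them can be used alone. -/
theorem sum_cosetApply_eq_zero [Fact p.Prime] [Fintype (H ⧸ Q)] (hM : ∀ m : M, p • m = 0)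
    (hρ : ∀ h, ρ (1, h) = 1) {A : Subgroup (G × H)} (hA : A ∈ prodSubgroups p G H) (hA1 : A ≠ ⊥)
    (s : equivariantFun ((MonoidHom.id G).prodMap Q.subtype) ⊥ (resRep Q ρ) A) :
    ∑ y : H ⧸ Q, cosetApply s 1 y = 0 := by
  obtain ⟨⟨⟨a, b⟩, hab⟩, hne⟩ := Subgroup.ne_bot_iff_exists_ne_one.1 hA1
  have ha := hA.2 _ hab
  have hb := snd_mem_of_mem_prodSubgroups hA hab
  by_cases ha1 : a = 1
  -- Here `⟨b⟩` permutes the cosets and preserves the summand. At a fixed coset `y Q` the nontrivial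
  -- element `y⁻¹ b y` of `Q` stabilizes the point, so the summand is zero.
  · have hb1 : b ≠ 1 := fun hb1 => hne (Subtype.ext (Prod.ext ha1 hb1))
    let P : Subgroup H := Subgroup.zpowers b
    have hPA : ∀ c ∈ P, ((1, c) : G × H) ∈ A := by
      rintro _ ⟨n, rfl⟩
      have := A.zpow_mem hb n
      simpa using this
    have hP : IsPGroup p P := by
      rw [isPGroup_iff_forall_mem]
      intro c hc
      obtain ⟨n, hn⟩ := isPGroup_iff_forall_mem.1 hA.1 _ (hPA c hc)
      exact ⟨n, by simpa using congrArg Prod.snd hn⟩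
    refine sum_eq_zero_of_isPGroup hP hM _ (fun c y => ?_) (fun y hy => ?_)
    · induction y using QuotientGroup.induction_on with
      | H y =>
        have h1 : c • (y : H ⧸ Q) = ((c.1 * y : H) : H ⧸ Q) := rfl
        rw [h1, cosetApply_mk hρ, cosetApply_mk hρ, ← s.2.1 (1, y⁻¹) _ (A.inv_mem (hPA _ c.2))]
        simp
    · induction y using QuotientGroup.induction_on with
      | H y =>
        have h1 : (((b * y : H) : H ⧸ Q)) = y := hy ⟨b, Subgroup.mem_zpowers b⟩
        rw [eq_comm, QuotientGroup.eq] at h1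
        rw [cosetApply_mk hρ]
        refine s.2.2.2.2 _ (1, ⟨y⁻¹ * (b * y), h1⟩) (fun h2 => hb1 ?_) ?_
        · have h3 := congrArg (fun x : G × Q => x.2.1) h2
          have h4 : y⁻¹ * (b * y) = 1 := h3
          rw [← mul_assoc, mul_eq_one_iff_eq_inv] at h4
          exact mul_left_cancel (h4.trans (mul_one _).symm)
        · convert hb using 1
          ext <;> simp [mul_assoc]
  -- Here `(a, 1)` stabilizes every point occurring in the sum.
  · refine Finset.sum_eq_zero fun y _ => s.2.2.2.2 _ (a, 1) (fun h => ha1 (congrArg Prod.fst h)) ?_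
    convert ha using 1
    ext <;> simp

variable (Q ρ) in
/-- The transfer map, scaled by `u`. -/
noncomputable def transferMap [Fact p.Prime] [Fintype (H ⧸ Q)] (hM : ∀ m : M, p • m = 0)
    (hρ : ∀ h, ρ (1, h) = 1) (u : k) (A : Orb (prodSubgroups p G H)) :
    equivariantFun ((MonoidHom.id G).prodMap Q.subtype) ⊥ (resRep Q ρ) A.sub →+
      atomicSubgroup M A.sub :=
  AddMonoidHom.mk' (fun s => ⟨u • ∑ y : H ⧸ Q, cosetApply s 1 y, mem_atomicSubgroup.2 fun hA => by
    rw [sum_cosetApply_eq_zero hM hρ A.mem hA s, smul_zero]⟩) (fun s t => Subtype.ext <| by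
      change u • ∑ y : H ⧸ Q, (cosetApply s 1 y + cosetApply t 1 y) = _
      rw [Finset.sum_add_distrib, smul_add]
      rfl)

variable (Q ρ) in
/-- The transfer from the functor induced from `G × Q` to the atomic functor. -/
noncomputable def transferHom [Fact p.Prime] [Fintype (H ⧸ Q)] (hM : ∀ m : M, p • m = 0)
    (hρ : ∀ h, ρ (1, h) = 1) (u : k) :
    (orbInductionProdSubgroup p G Q).funFunctor (resRep Q ρ) ⟶
      orbAtomic (prodSubgroups p G H) ρ where
  app A := AddCommGrpCat.ofHom (transferMap Q ρ hM hρ u A.unop)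
  naturality B A φ := by
    refine AddCommGrpCat.hom_ext <| AddMonoidHom.ext fun s => Subtype.ext ?_
    let s' : equivariantFun ((MonoidHom.id G).prodMap Q.subtype) ⊥ (resRep Q ρ) B.unop.sub := s
    let a := Orb.rep φ.unop
    change u • ∑ y : H ⧸ Q, cosetApply ((orbInductionProdSubgroup p G Q).equivariantFunMap
      (resRep Q ρ) φ.unop s') 1 y = ρ a (u • ∑ y : H ⧸ Q, cosetApply s' 1 y)
    have ha : ρ a = ρ (a.1, 1) := by
      have : a = (a.1, 1) * (1, a.2) := by ext <;> simp
      rw [this, map_mul, hρ, mul_one]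
      simp
    -- The second component of `a` only permutes the cosets, which does not change the sum; the
    -- first component acts through `ρ`.
    have h1 : ∀ y : H ⧸ Q, cosetApply ((orbInductionProdSubgroup p G Q).equivariantFunMap
        (resRep Q ρ) φ.unop s') 1 y = cosetApply s' a.1 (a.2⁻¹ • y) := fun y => by
      have h2 : a.2⁻¹ • y = ((a.2⁻¹ * y.out : H) : H ⧸ Q) := by
        conv_lhs => rw [← QuotientGroup.out_eq' y]
        rfl
      rw [h2, cosetApply_mk hρ, cosetApply, OrbInduction.equivariantFunMap_apply,
        if_pos (conjLE_bot _ _)]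
      refine congrArg s'.1 (?_ : ((1 : G), y.out⁻¹) * a = _)
      ext <;> simp
    have h3 : ∀ y : H ⧸ Q, cosetApply s' a.1 y = ρ (a.1, 1) (cosetApply s' 1 y) := fun y => by
      refine Eq.trans ?_ (s'.2.2.1 (a.1, 1) (1, y.out⁻¹))
      refine congrArg s'.1 ?_
      ext <;> simp
    rw [Finset.sum_congr rfl (fun y _ => h1 y),
      show ∑ y : H ⧸ Q, cosetApply s' a.1 (a.2⁻¹ • y) = ∑ y : H ⧸ Q, cosetApply s' a.1 y from
        Equiv.sum_comp (MulAction.toPerm a.2⁻¹ : Equiv.Perm (H ⧸ Q)) (cosetApply s' a.1),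
      Finset.sum_congr rfl (fun y _ => h3 y), ← map_sum, ha, map_smul]

/-- The higher limits of an atomic functor over the products in `G × H` vanish if `H` acts
trivially and `p` divides its order. -/
theorem isZero_higherLimit_orbAtomic_prodSubgroups [Fact p.Prime] [Finite H]
    [Module (ZMod p) M] (ρ : Representation (ZMod p) (G × H) M) (hp : p ∣ Nat.card H)
    (hρ : ∀ h, ρ (1, h) = 1) (i : ℕ) :
    IsZero (higherLimit i (orbAtomic (prodSubgroups p G H) ρ)) := by
  -- Restriction to `G × Q` followed by transfer is multiplication by the index of `Q`, a unit mod
  -- `p`. Hence the atomic functor is a retract of one induced from `G × Q`, where `Q` is a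
  -- nontrivial `p`-group.
  have Q : Sylow p H := default
  have : Fintype (H ⧸ Q.1) := Fintype.ofFinite _
  have hM : ∀ m : M, p • m = 0 := fun m => by
    rw [← Nat.cast_smul_eq_nsmul (ZMod p), CharP.cast_eq_zero, zero_smul]
  have hindex : ((Fintype.card (H ⧸ Q.1) : ℕ) : ZMod p) ≠ 0 := by
    rw [Ne, ZMod.natCast_eq_zero_iff, ← Nat.card_eq_fintype_card]
    exact Q.not_dvd_index
  have : Nontrivial Q.1 := by
    rw [Subgroup.nontrivial_iff_ne_bot]
    exact Q.ne_bot_of_dvd_card hp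
  refine isZero_higherLimit_of_retract i (restrictionHom p Q.1 ρ)
    (transferHom Q.1 ρ hM hρ (Fintype.card (H ⧸ Q.1) : ZMod p)⁻¹) ?_ ?_
  · refine NatTrans.ext (funext fun A => AddCommGrpCat.hom_ext <| AddMonoidHom.ext fun n =>
      Subtype.ext ?_)
    let n' : atomicSubgroup M A.unop.sub := n
    change (Fintype.card (H ⧸ Q.1) : ZMod p)⁻¹ •
      ∑ y : H ⧸ Q.1, cosetApply (orbitMap Q.1 ρ A.unop.sub n') 1 y = n'.1
    have h1 : ∀ y : H ⧸ Q.1, cosetApply (orbitMap Q.1 ρ A.unop.sub n') 1 y = n'.1 := fun y => by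
      change ρ (1, _) n'.1 = n'.1
      rw [hρ]
      rfl
    rw [Finset.sum_congr rfl (fun y _ => h1 y), Finset.sum_const, Finset.card_univ,
      ← Nat.cast_smul_eq_nsmul (ZMod p), smul_smul, inv_mul_cancel₀ hindex, one_smul]
  · obtain ⟨e⟩ := (orbInductionProdSubgroup p G Q.1).higherLimit_funFunctor_iso (resRep Q.1 ρ) i
    refine IsZero.of_iso ?_ e
    exact isZero_higherLimit_orbAtomic_of_isPGroup (Q.2.of_equiv Subgroup.topEquiv.symm) _ i

/-- The higher limits of an atomic functor over the `p`-subgroups of `G × H` agree with those over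
the products. -/
theorem higherLimit_orbAtomic_prodSubgroups_iso (ρ : Representation k (G × H) M) (i : ℕ) :
    Nonempty (higherLimit i (orbAtomic (prodSubgroups p G H) ρ) ≅
      higherLimit i (orbAtomic (pSubgroups p (G × H)) ρ)) := by
  let d := orbInductionProdHull p G H
  obtain ⟨e⟩ := d.higherLimit_funFunctor_iso ρ i
  refine ⟨higherLimitIso i ?_ ≪≫ e⟩
  -- An equivariant function on all of `G × H` is determined by its value at `1`, so this Kan
  -- extension is again atomic.
  let f : ∀ A : Orb (prodSubgroups p G H), equivariantFun (MonoidHom.id (G × H)) ⊥ ρ A.sub →+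
      atomicSubgroup M A.sub := fun A => AddMonoidHom.mk' (fun s => ⟨s.1 1,
    mem_atomicSubgroup.2 fun hA => by
      obtain ⟨⟨a, ha⟩, ha1⟩ := Subgroup.ne_bot_iff_exists_ne_one.1 hA
      exact s.2.2.2.2 1 a (fun h => ha1 (Subtype.ext h)) (by simpa using ha)⟩) (fun _ _ => rfl)
  have hf : ∀ A, Function.Bijective (f A) := fun A => by
    have hs : ∀ (s : equivariantFun (MonoidHom.id (G × H)) ⊥ ρ A.sub) g,
        s.1 g = ρ g (f A s).1 := fun s g => by
      have := s.2.2.1 g 1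
      rwa [MonoidHom.id_apply, mul_one] at this
    constructor
    · intro s t hst
      refine Subtype.ext (funext fun g => ?_)
      rw [hs, hs, hst]
    · intro n
      refine ⟨⟨fun g => ρ g n.1, ?_⟩, ?_⟩
      · refine ⟨fun g a ha => ?_, fun h g => by simp, fun g hg => absurd (conjLE_bot g _) hg,
          fun g h hh hg => ?_⟩
        · by_cases hA : A.sub = ⊥
          · rw [hA, Subgroup.mem_bot] at ha
            rw [ha, mul_one]
          · simp [mem_atomicSubgroup.1 n.2 hA]
        · beta_reduce
          rw [mem_atomicSubgroup.1 n.2, map_zero]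
          intro hA
          rw [hA, Subgroup.mem_bot] at hg
          apply hh
          have h2 := congrArg (fun x => g * x * g⁻¹) hg
          simpa [mul_assoc] using h2
      · refine Subtype.ext ?_
        change ρ 1 n.1 = n.1
        simp
  refine (NatIso.ofComponents (fun A => (AddEquiv.ofBijective (f A.unop)
    (hf _)).toAddCommGrpIso) ?_).symm
  intro B A φ
  refine AddCommGrpCat.hom_ext <| AddMonoidHom.ext fun s => Subtype.ext ?_
  let s' : equivariantFun (MonoidHom.id (G × H)) ⊥ ρ B.unop.sub := s
  change (d.equivariantFunMap ρ φ.unop s').1 1 = ρ (Orb.rep φ.unop) (s'.1 1)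
  rw [OrbInduction.equivariantFunMap_apply, if_pos (conjLE_bot _ _), ← s'.2.2.1]
  simp

/-- The higher limits of an atomic functor over the `p`-subgroups of `G × H` vanish if `H` acts
trivially and `p` divides its order. -/
theorem isZero_higherLimit_orbAtomic_prod [Fact p.Prime] [Finite H]
    [Module (ZMod p) M] (ρ : Representation (ZMod p) (G × H) M) (hp : p ∣ Nat.card H)
    (hρ : ∀ h, ρ (1, h) = 1) (i : ℕ) :
    IsZero (higherLimit i (orbAtomic (pSubgroups p (G × H)) ρ)) := by
  obtain ⟨e⟩ := higherLimit_orbAtomic_prodSubgroups_iso (p := p) ρ i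
  exact IsZero.of_iso (isZero_higherLimit_orbAtomic_prodSubgroups ρ hp hρ i) e.symm

end Transfer

end Vanishing

theorem shortExact_of_app {C : Type u} [SmallCategory C]
    (S : ShortComplex (Cᵒᵖ ⥤ AddCommGrpCat.{u}))
    (hf : ∀ c, Function.Injective (S.f.app c).hom)
    (hg : ∀ c, Function.Surjective (S.g.app c).hom)
    (h : ∀ c x, (S.g.app c).hom x = 0 → ∃ y, (S.f.app c).hom y = x) : S.ShortExact where
  exact := by
    rw [S.exact_iff_isZero_homology]
    refine Functor.isZero _ fun c => ?_
    refine IsZero.of_iso ?_ (S.mapHomologyIso ((evaluation _ _).obj c)).symm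
    rw [← ShortComplex.exact_iff_isZero_homology, ShortComplex.ab_exact_iff]
    exact h c
  mono_f := by
    rw [NatTrans.mono_iff_mono_app]
    exact fun c => (AddCommGrpCat.mono_iff_injective _).2 (hf c)
  epi_g := by
    rw [NatTrans.epi_iff_epi_app]
    exact fun c => (AddCommGrpCat.epi_iff_surjective _).2 (hg c)

/-! ### The middle term, induced from the base group -/

section Wreath

open RegularWreathProduct

variable {p : ℕ} {Γ : Type u} [Group Γ]

theorem wreath_mul_left_apply (a b : Γ ≀ᵣ CyclicGroup p) (x : CyclicGroup p) :
    (a * b).left x = a.left x * b.left (a.right⁻¹ * x) := rfl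

theorem wreath_inv_left_apply (a : Γ ≀ᵣ CyclicGroup p) (x : CyclicGroup p) :
    a⁻¹.left x = (a.left (a.right * x))⁻¹ := rfl

open Classical in
/-- The base group of the wreath product, with the factor at `1` split off. -/
noncomputable def baseHom (p : ℕ) (Γ : Type u) [Group Γ] :
    Γ × ({x : CyclicGroup p // x ≠ 1} → Γ) →* Γ ≀ᵣ CyclicGroup p where
  toFun h := ⟨fun x => if hx : x = 1 then h.1 else h.2 ⟨x, hx⟩, 1⟩
  map_one' := by
    ext x
    · simp
    · rfl
  map_mul' a b := by
    ext x
    · rw [wreath_mul_left_apply]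
      by_cases hx : x = 1 <;> simp [hx]
    · simp

theorem baseHom_left_one (h : Γ × ({x : CyclicGroup p // x ≠ 1} → Γ)) :
    (baseHom p Γ h).left 1 = h.1 := dif_pos rfl

theorem baseHom_right (h : Γ × ({x : CyclicGroup p // x ≠ 1} → Γ)) :
    (baseHom p Γ h).right = 1 := rfl

theorem baseHom_surj (w : Γ ≀ᵣ CyclicGroup p) (hw : w.right = 1) :
    baseHom p Γ (w.left 1, fun x => w.left x.1) = w := by
  ext x
  · by_cases hx : x = 1 <;> simp [baseHom, hx]
  · rw [baseHom_right, hw]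

theorem baseHom_injective : Function.Injective (baseHom p Γ) := by
  intro a b hab
  refine Prod.ext ?_ (funext fun x => ?_)
  · rw [← baseHom_left_one a, hab, baseHom_left_one]
  · have := congrArg (fun w => w.left x.1) hab
    simpa [baseHom, x.2] using this

/-- The functor of orbit categories induced by the inclusion of the base group. -/
noncomputable def orbInductionBase (p : ℕ) (Γ : Type u) [Group Γ] :
    OrbInduction (baseHom p Γ) ⊥ (pSubgroups p _) (pSubgroups p (Γ ≀ᵣ CyclicGroup p)) where
  obj P := P.map (baseHom p Γ)
  obj_mem _ hP := IsPGroup.map hP _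
  conjLE_iff _ _ A _ g := ⟨fun h => ⟨h, conjLE_bot g A⟩, fun h => h.1⟩
  normalizes _ := conjLE_bot _ _
  bot_mem := bot_mem_pSubgroups p
  stab_mem A hA g _ := ⟨pointStabilizer _ g A,
    isPGroup_pointStabilizer baseHom_injective g hA, fun _ => mem_pointStabilizer⟩

variable {k : Type*} [CommRing k] {M : Type u} [AddCommGroup M] [Module k M]
  (ρ : Representation k Γ M)

theorem wreathRep_apply (w : Γ ≀ᵣ CyclicGroup p) (ξ : CyclicGroup p → M) (x : CyclicGroup p) :
    wreathRep ρ w ξ x = ρ (w.left x) (ξ (w.right⁻¹ * x)) := rfl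

theorem wreathRep_mul_apply (v w : Γ ≀ᵣ CyclicGroup p) (ξ : CyclicGroup p → M) :
    wreathRep ρ (v * w) ξ = wreathRep ρ v (wreathRep ρ w ξ) := by
  rw [map_mul]
  rfl

theorem wreathRep_inl_apply (c : CyclicGroup p) (ξ : CyclicGroup p → M) (x : CyclicGroup p) :
    wreathRep ρ (inl c) ξ x = ξ (c⁻¹ * x) := by
  rw [wreathRep_apply]
  simp

/-- The elements of `M^p` fixed by `A` if `A` meets the base group trivially, and `0` otherwise. -/
def baseFixed (A : Subgroup (Γ ≀ᵣ CyclicGroup p)) : AddSubgroup (CyclicGroup p → M) where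
  carrier := {ξ | (∀ a ∈ A, wreathRep ρ a ξ = ξ) ∧ ∀ a ∈ A, a ≠ 1 → a.right = 1 → ξ = 0}
  zero_mem' := ⟨fun a _ => map_zero _, fun _ _ _ _ => rfl⟩
  add_mem' {ξ η} hξ hη := ⟨fun a ha => by rw [map_add, hξ.1 a ha, hη.1 a ha],
    fun a ha h1 h2 => by rw [hξ.2 a ha h1 h2, hη.2 a ha h1 h2, add_zero]⟩
  neg_mem' {ξ} hξ := ⟨fun a ha => by rw [map_neg, hξ.1 a ha],
    fun a ha h1 h2 => by rw [hξ.2 a ha h1 h2, neg_zero]⟩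

variable (p) in
/-- The functor `A ↦ baseFixed A`. -/
noncomputable def baseFixedFunctor :
    (Orb (pSubgroups p (Γ ≀ᵣ CyclicGroup p)))ᵒᵖ ⥤ AddCommGrpCat.{u} :=
  fixedFunctor _ (wreathRep (p := p) ρ) (baseFixed ρ) (fun _ _ _ hξ a ha => hξ.1 a ha)
    (fun A B g hg ξ hξ => by
      refine ⟨fun a ha => ?_, fun a ha h1 h2 => ?_⟩
      · rw [← wreathRep_mul_apply, show a * g = g * (g⁻¹ * a * g) by group, wreathRep_mul_apply,
          hξ.1 _ (hg a ha)]
      · rw [hξ.2 _ (hg a ha), map_zero]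
        · intro h3
          apply h1
          have h4 := congrArg (fun x => g * x * g⁻¹) h3
          simpa [mul_assoc] using h4
        · simp [h2])

/-- The representation of the base group on the factor of `M^p` at `1`. -/
abbrev baseRep (p : ℕ) : Representation k (Γ × ({x : CyclicGroup p // x ≠ 1} → Γ)) M :=
  ρ.comp (MonoidHom.fst _ _)

/-- The function `g ↦ (g ξ)(1)`. -/
noncomputable def baseFun (A : Subgroup (Γ ≀ᵣ CyclicGroup p)) :
    baseFixed ρ A →+ equivariantFun (baseHom p Γ) ⊥ (baseRep ρ p) A :=
  AddMonoidHom.mk' (fun ξ => ⟨fun g => wreathRep ρ g ξ.1 1, by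
    refine ⟨fun g a ha => ?_, fun h g => ?_, fun g hg => absurd (conjLE_bot g _) hg,
      fun g h hh hg => ?_⟩
    · beta_reduce
      rw [wreathRep_mul_apply, ξ.2.1 a ha]
    · beta_reduce
      rw [wreathRep_mul_apply, wreathRep_apply, baseHom_left_one, baseHom_right]
      simp
    · beta_reduce
      rw [ξ.2.2 _ hg, map_zero, Pi.zero_apply]
      · intro h3
        apply hh
        apply baseHom_injective
        have h4 := congrArg (fun x => g * x * g⁻¹) h3
        rw [map_one]
        simpa [mul_assoc] using h4
      · simp [baseHom_right]⟩) (fun ξ η => Subtype.ext (funext fun g => by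
        change wreathRep ρ g (ξ.1 + η.1) 1 = _
        rw [map_add]
        rfl))

theorem baseFun_apply (A : Subgroup (Γ ≀ᵣ CyclicGroup p)) (ξ : baseFixed ρ A)
    (g : Γ ≀ᵣ CyclicGroup p) : (baseFun ρ A ξ).1 g = wreathRep ρ g ξ.1 1 := rfl

/-- This is the coinduction of `M^p` from the base group: the elements `inl x⁻¹` represent its
cosets and move coordinate `x` to position `1`. Conjugating by them turns a nontrivial base element
of `A` into a stabilizer of each such point, which matches the two vanishing conditions. -/
theorem baseFun_bijective (A : Subgroup (Γ ≀ᵣ CyclicGroup p)) :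
    Function.Bijective (baseFun ρ A) := by
  constructor
  · intro ξ η h
    refine Subtype.ext (funext fun x => ?_)
    have h1 := congrArg (fun s => s.1 (inl x⁻¹)) h
    beta_reduce at h1
    rw [baseFun_apply, baseFun_apply, wreathRep_inl_apply, wreathRep_inl_apply] at h1
    simpa using h1
  · intro s
    have key : ∀ g, wreathRep ρ g (fun x => s.1 (inl x⁻¹)) 1 = s.1 g := fun g => by
      rw [wreathRep_apply]
      have h1 := s.2.2.1 (g.left 1, fun x => g.left x.1) (inl g.right)
      have h2 : baseHom p Γ (g.left 1, fun x => g.left x.1) * inl g.right = g := by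
        have h3 := baseHom_surj (⟨g.left, 1⟩ : Γ ≀ᵣ CyclicGroup p) rfl
        rw [h3]
        ext x <;> simp
      rw [h2] at h1
      simpa using h1.symm
    refine ⟨⟨fun x => s.1 (inl x⁻¹), fun a ha => funext fun x => ?_, fun a ha h1 h2 => ?_⟩,
      Subtype.ext (funext key)⟩
    · have h1 := key (inl x⁻¹ * a)
      rw [wreathRep_mul_apply, wreathRep_inl_apply, s.2.1 _ a ha] at h1
      simpa using h1
    · refine funext fun x => ?_
      let w := inl x⁻¹ * a * (inl x⁻¹)⁻¹
      have hw : w.right = 1 := by simp [w, h2]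
      refine s.2.2.2.2 _ (w.left 1, fun x => w.left x.1) (fun h3 => h1 ?_) ?_
      · have h4 : w = 1 := by rw [← baseHom_surj w hw, h3, map_one]
        have h5 := congrArg (fun y => (inl x⁻¹)⁻¹ * y * (inl x⁻¹)) h4
        simpa [w, mul_assoc] using h5
      · rw [baseHom_surj w hw]
        simpa [w, mul_assoc] using ha

/-- The higher limits of `A ↦ baseFixed A` vanish. -/
theorem isZero_higherLimit_baseFixedFunctor [Fact p.Prime] [Finite Γ]
    [Module (ZMod p) M] (ρ : Representation (ZMod p) Γ M) (hp : p ∣ Nat.card Γ) (i : ℕ) :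
    IsZero (higherLimit i (baseFixedFunctor p ρ)) := by
  let d := orbInductionBase p Γ
  have e : baseFixedFunctor p ρ ≅ d.funFunctor (baseRep ρ p) :=
    NatIso.ofComponents (fun A => (AddEquiv.ofBijective _
      (baseFun_bijective ρ A.unop.sub)).toAddCommGrpIso) (by
      intro B A φ
      refine AddCommGrpCat.hom_ext <| AddMonoidHom.ext fun ξ => Subtype.ext <| funext fun g => ?_
      let ξ' : baseFixed ρ B.unop.sub := ξ
      change wreathRep ρ g (wreathRep ρ (Orb.rep φ.unop) ξ'.1) 1 =
        (d.equivariantFunMap (baseRep ρ p) φ.unop (baseFun ρ _ ξ')).1 g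
      rw [OrbInduction.equivariantFunMap_apply, if_pos (conjLE_bot g _), baseFun_apply,
        wreathRep_mul_apply])
  obtain ⟨e'⟩ := d.higherLimit_funFunctor_iso (baseRep ρ p) i
  refine IsZero.of_iso ?_ (higherLimitIso i e ≪≫ e')
  refine isZero_higherLimit_orbAtomic_prod _ ?_ (fun h => by simp) i
  -- The order of the second factor is a power of `Nat.card Γ`, with positive exponent because `C_p`
  -- is nontrivial.
  rw [Nat.card_fun]
  refine dvd_pow hp ?_
  have h2 : Nontrivial (CyclicGroup p) := by
    have : Fact (1 < p) := ⟨(Fact.out : p.Prime).one_lt⟩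
    exact inferInstanceAs (Nontrivial (ZMod p))
  obtain ⟨x, hx⟩ := exists_ne (1 : CyclicGroup p)
  have : NeZero p := ⟨(Fact.out : p.Prime).ne_zero⟩
  have h3 : Finite (CyclicGroup p) := inferInstanceAs (Finite (ZMod p))
  have h4 : Nonempty {x : CyclicGroup p // x ≠ 1} := ⟨⟨x, hx⟩⟩
  exact Nat.card_pos.ne'

end Wreath

/-! ### The quotient term, induced from the diagonal, and the short exact sequence -/

section Diagonal

open RegularWreathProduct

variable {p : ℕ} {Γ : Type u} [Group Γ]

/-- The subgroup `C_p` of the wreath product. -/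
def topSubgroup (p : ℕ) (Γ : Type u) [Group Γ] : Subgroup (Γ ≀ᵣ CyclicGroup p) :=
  (inl : CyclicGroup p →* Γ ≀ᵣ CyclicGroup p).range

theorem conjLE_topSubgroup {g : Γ ≀ᵣ CyclicGroup p} {A : Subgroup (Γ ≀ᵣ CyclicGroup p)} :
    ConjLE g (topSubgroup p Γ) A ↔ ∀ c : CyclicGroup p, g⁻¹ * inl c * g ∈ A :=
  ⟨fun h c => h _ ⟨c, rfl⟩, fun h => by rintro _ ⟨c, rfl⟩; exact h c⟩

/-- The inclusion of `Γ × C_p` with the diagonal subgroup as first factor. -/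
def diagProdHom (p : ℕ) (Γ : Type u) [Group Γ] :
    Γ × CyclicGroup p →* Γ ≀ᵣ CyclicGroup p where
  toFun w := ⟨fun _ => w.1, w.2⟩
  map_one' := rfl
  map_mul' _ _ := rfl

/-- The diagonal inclusion of `Γ`. -/
def diagHom (p : ℕ) (Γ : Type u) [Group Γ] : Γ →* Γ ≀ᵣ CyclicGroup p where
  toFun w := ⟨fun _ => w, 1⟩
  map_one' := rfl
  map_mul' _ _ := by
    ext
    · rfl
    · simp

theorem diagHom_injective : Function.Injective (diagHom p Γ) := fun _ _ h =>
  congrFun (congrArg RegularWreathProduct.left h) 1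

theorem diagHom_mul_inl (γ : Γ) (c : CyclicGroup p) :
    diagHom p Γ γ * inl c = diagProdHom p Γ (γ, c) := by
  ext x
  · rw [wreath_mul_left_apply]
    simp [diagHom, diagProdHom]
  · simp [diagHom, diagProdHom]

theorem diagHom_comm_inl (γ : Γ) (c : CyclicGroup p) :
    diagHom p Γ γ * inl c = inl c * diagHom p Γ γ := by
  ext x
  · rw [wreath_mul_left_apply, wreath_mul_left_apply]
    simp [diagHom]
  · simp [diagHom]

/-- An element of the wreath product that commutes with `C_p` has constant coordinates. -/
theorem left_eq_of_comm_inl {w : Γ ≀ᵣ CyclicGroup p} (h : ∀ c, w * inl c = inl c * w) :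
    w = diagHom p Γ (w.left 1) * inl w.right := by
  have h1 : ∀ x, w.left x = w.left 1 := fun x => by
    have h2 := congrFun (congrArg RegularWreathProduct.left (h x)) x
    rw [wreath_mul_left_apply, wreath_mul_left_apply] at h2
    simpa using h2
  ext x
  · rw [wreath_mul_left_apply, h1]
    simp [diagHom]
  · simp [diagHom]

theorem isPGroup_cyclicGroup [Fact p.Prime] : IsPGroup p (CyclicGroup p) := by
  refine IsPGroup.of_card (n := 1) ?_
  rw [pow_one]
  exact Nat.card_zmod p

/-- The functor of orbit categories that sends `P` to the subgroup generated by the diagonal copy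
of `P` and `C_p`. -/
def orbInductionDiag (p : ℕ) [Fact p.Prime] (Γ : Type u) [Group Γ] :
    OrbInduction (diagHom p Γ) (topSubgroup p Γ) (pSubgroups p Γ)
      (pSubgroups p (Γ ≀ᵣ CyclicGroup p)) where
  obj P := (P.prod ⊤).map (diagProdHom p Γ)
  obj_mem P hP := IsPGroup.map (isPGroup_prod hP
    (isPGroup_cyclicGroup.of_equiv Subgroup.topEquiv.symm)) _
  conjLE_iff P _ A _ g := by
    constructor
    · intro h
      constructor
      · rintro _ ⟨γ, hγ, rfl⟩
        exact h _ ⟨(γ, 1), ⟨hγ, Subgroup.mem_top _⟩, rfl⟩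
      · rintro _ ⟨c, rfl⟩
        exact h _ ⟨(1, c), ⟨Subgroup.one_mem _, Subgroup.mem_top _⟩, rfl⟩
    · rintro ⟨h1, h2⟩ _ ⟨⟨γ, c⟩, ⟨hγ, -⟩, rfl⟩
      rw [← diagHom_mul_inl]
      have := A.mul_mem (h1 _ ⟨γ, hγ, rfl⟩) (h2 _ ⟨c, rfl⟩)
      simpa [mul_assoc] using this
  normalizes γ := by
    rintro _ ⟨c, rfl⟩
    rw [mul_assoc, ← diagHom_comm_inl, inv_mul_cancel_left]
    exact ⟨c, rfl⟩
  bot_mem := bot_mem_pSubgroups p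
  stab_mem A hA g _ := ⟨pointStabilizer _ g A,
    isPGroup_pointStabilizer diagHom_injective g hA, fun _ => mem_pointStabilizer⟩

/-- A nontrivial subgroup that meets the base group trivially contains a conjugate of `C_p`. -/
theorem exists_conjLE_topSubgroup [Fact p.Prime] {A : Subgroup (Γ ≀ᵣ CyclicGroup p)}
    (hA : A ≠ ⊥) (hA1 : ∀ a ∈ A, a.right = 1 → a = 1) :
    ∃ g, ConjLE g (topSubgroup p Γ) A := by
  have hinj : ∀ a ∈ A, ∀ b ∈ A, a.right = b.right → a = b := fun a ha b hb hab => by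
    rw [← mul_inv_eq_one]
    refine hA1 _ (A.mul_mem ha (A.inv_mem hb)) ?_
    simp [hab]
  have htop : A.map rightHom = ⊤ := by
    have hcard : (Nat.card (CyclicGroup p)).Prime := by
      have : Nat.card (CyclicGroup p) = p := Nat.card_zmod p
      rw [this]
      exact Fact.out
    have : Fact (Nat.card (CyclicGroup p)).Prime := ⟨hcard⟩
    refine (Subgroup.eq_bot_or_eq_top_of_prime_card (A.map rightHom)).resolve_left fun h => hA ?_
    rw [Subgroup.eq_bot_iff_forall] at h ⊢
    exact fun a ha => hA1 a ha (h _ ⟨a, ha, rfl⟩)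
  have hsurj : ∀ c : CyclicGroup p, ∃ a ∈ A, a.right = c := fun c => by
    have : c ∈ A.map rightHom := htop ▸ Subgroup.mem_top c
    exact this
  choose τ hτA hτ using hsurj
  have hmul : ∀ c c', τ (c * c') = τ c * τ c' := fun c c' =>
    hinj _ (hτA _) _ (A.mul_mem (hτA _) (hτA _)) (by simp [hτ])
  -- The section `τ` of `A → C_p` is a cocycle with values in `Γ^p`, which is coinduced, so it is a
  -- coboundary; the bounding element is read off at coordinate `1`.
  refine ⟨⟨fun x => (τ x⁻¹).left 1, 1⟩, conjLE_topSubgroup.2 fun c => ?_⟩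
  convert hτA c using 1
  ext x
  · have h1 : (τ (x⁻¹ * c)).left 1 = (τ x⁻¹).left 1 * (τ c).left x := by
      rw [hmul, wreath_mul_left_apply, hτ]
      simp
    have h2 : (c⁻¹ * x)⁻¹ = x⁻¹ * c := by group
    simp only [wreath_mul_left_apply, wreath_inv_left_apply, mul_right, inv_right, right_inl,
      left_inl, inv_one, one_mul, mul_one, Pi.one_apply, h2, h1]
    group
  · simp [hτ]

/-- If a `p`-subgroup contains `C_p` and meets the base group nontrivially, then it contains a
nontrivial diagonal element. -/
theorem exists_diagHom_mem [Fact p.Prime] [Finite Γ] {L : Subgroup (Γ ≀ᵣ CyclicGroup p)}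
    (hL : IsPGroup p L) (hV : ∀ c, inl c ∈ L) {a : Γ ≀ᵣ CyclicGroup p} (ha : a ∈ L)
    (ha1 : a ≠ 1) (har : a.right = 1) : ∃ γ : Γ, γ ≠ 1 ∧ diagHom p Γ γ ∈ L := by
  have : NeZero p := ⟨(Fact.out : p.Prime).ne_zero⟩
  have : Finite (CyclicGroup p) := inferInstanceAs (Finite (ZMod p))
  let B : Subgroup (Γ ≀ᵣ CyclicGroup p) := L ⊓ rightHom.ker
  let act : MulAction (CyclicGroup p) B :=
    { smul := fun c b => ⟨inl c * b.1 * (inl c)⁻¹, L.mul_mem (L.mul_mem (hV c) b.2.1)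
        (L.inv_mem (hV c)), by
          have h := b.2.2
          have h2 : b.1.right = 1 := h
          change (inl c * b.1 * (inl c)⁻¹).right = 1
          simp [h2]⟩
      one_smul := fun b => Subtype.ext (by
        change inl 1 * b.1 * (inl 1)⁻¹ = b.1
        simp)
      mul_smul := fun c c' b => Subtype.ext (by
        change inl (c * c') * b.1 * (inl (c * c'))⁻¹ =
          inl c * (inl c' * b.1 * (inl c')⁻¹) * (inl c)⁻¹
        rw [map_mul]
        group) }
  have hB : IsPGroup p B := hL.to_le inf_le_left
  have hBn : Nontrivial B := by
    rw [Subgroup.nontrivial_iff_exists_ne_one]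
    exact ⟨a, ⟨ha, har⟩, ha1⟩
  have hcard : p ∣ Nat.card B := by
    obtain ⟨n, hn0, hn⟩ := hB.nontrivial_iff_card.1 hBn
    rw [hn]
    exact dvd_pow_self _ hn0.ne'
  -- A `p`-group acting on a set of size divisible by `p` with one fixed point has another. Fixed
  -- points of conjugation by `C_p` on the base group are diagonal.
  have h1 : (1 : B) ∈ MulAction.fixedPoints (CyclicGroup p) B := fun c => Subtype.ext (by
    change inl c * 1 * (inl c)⁻¹ = 1
    group)
  obtain ⟨b, hb, hb1⟩ := isPGroup_cyclicGroup.exists_fixed_point_of_prime_dvd_card_of_fixed_point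
    B hcard h1
  have hcomm : ∀ c, b.1 * inl c = inl c * b.1 := fun c => by
    have h2 : inl c * b.1 * (inl c)⁻¹ = b.1 := congrArg Subtype.val (hb c)
    rw [mul_inv_eq_iff_eq_mul] at h2
    exact h2.symm
  have hbr : b.1.right = 1 := b.2.2
  have h3 := left_eq_of_comm_inl hcomm
  rw [hbr, map_one, mul_one] at h3
  refine ⟨b.1.left 1, fun h4 => hb1 (Subtype.ext ?_), h3 ▸ b.2.1⟩
  rw [h3, h4, map_one]
  rfl

variable {k : Type*} [CommRing k] {M : Type u} [AddCommGroup M] [Module k M]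
  (ρ : Representation k Γ M)

theorem atomicSubgroup_le_baseFixed (A : Subgroup (Γ ≀ᵣ CyclicGroup p)) :
    atomicSubgroup (CyclicGroup p → M) A ≤ baseFixed ρ A := by
  intro ξ hξ
  rw [mem_atomicSubgroup] at hξ
  refine ⟨fun a ha => ?_, fun a ha ha1 _ => hξ fun hA => ?_⟩
  · by_cases hA : A = ⊥
    · rw [hA, Subgroup.mem_bot] at ha
      rw [ha, map_one]
      rfl
    · rw [hξ hA, map_zero]
  · rw [hA, Subgroup.mem_bot] at ha
    exact ha1 ha

variable (p) in
/-- The inclusion of the atomic functor of `M^p`. -/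
noncomputable def atomicToBaseFixed :
    orbAtomic (pSubgroups p _) (wreathRep (p := p) ρ) ⟶ baseFixedFunctor p ρ where
  app A := AddCommGrpCat.ofHom (AddSubgroup.inclusion (atomicSubgroup_le_baseFixed ρ A.unop.sub))
  naturality _ _ _ := rfl

open Classical in
/-- The function `g ↦ (g ξ)(1)` on the points fixed by `C_p`. -/
noncomputable def diagFun (A : Subgroup (Γ ≀ᵣ CyclicGroup p)) :
    baseFixed ρ A →+ equivariantFun (diagHom p Γ) (topSubgroup p Γ) ρ A :=
  AddMonoidHom.mk' (fun ξ =>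
    ⟨fun g => if ConjLE g (topSubgroup p Γ) A then wreathRep ρ g ξ.1 1 else 0, by
    refine ⟨fun g a ha => ?_, fun h g => ?_, fun g hg => if_neg hg,
      fun g h hh hg => ?_⟩
    · have h1 : ConjLE (g * a) (topSubgroup p Γ) A ↔ ConjLE g (topSubgroup p Γ) A :=
        (ConjLE.congr_iff (by simpa using ha)).symm
      beta_reduce
      rw [wreathRep_mul_apply, ξ.2.1 a ha]
      simp only [h1]
    · have h1 : ConjLE (diagHom p Γ h * g) (topSubgroup p Γ) A ↔
          ConjLE g (topSubgroup p Γ) A := by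
        simp only [conjLE_topSubgroup]
        refine forall_congr' fun c => ?_
        rw [show (diagHom p Γ h * g)⁻¹ * inl c * (diagHom p Γ h * g) =
          g⁻¹ * (diagHom p Γ h)⁻¹ * (inl c * diagHom p Γ h) * g by group, ← diagHom_comm_inl]
        simp [mul_assoc]
      beta_reduce
      simp only [h1]
      split_ifs
      · rw [wreathRep_mul_apply, wreathRep_apply]
        simp [diagHom]
      · simp
    · beta_reduce
      rw [ξ.2.2 _ hg, map_zero, Pi.zero_apply, ite_self]
      · intro h3
        apply hh
        apply diagHom_injective (p := p)
        have h4 := congrArg (fun x => g * x * g⁻¹) h3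
        rw [map_one]
        simpa [mul_assoc] using h4
      · simp [diagHom]⟩) (fun ξ η => Subtype.ext (funext fun g => by
        change (if _ then wreathRep ρ g (ξ.1 + η.1) 1 else 0) =
          (if _ then wreathRep ρ g ξ.1 1 else 0) + (if _ then wreathRep ρ g η.1 1 else 0)
        rw [map_add]
        split_ifs <;> simp))

open Classical in
theorem diagFun_apply (A : Subgroup (Γ ≀ᵣ CyclicGroup p)) (ξ : baseFixed ρ A)
    (g : Γ ≀ᵣ CyclicGroup p) : (diagFun ρ A ξ).1 g =
      if ConjLE g (topSubgroup p Γ) A then wreathRep ρ g ξ.1 1 else 0 := rfl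

/-- Needed for the composite in the short exact sequence to vanish: at the trivial subgroup the
quotient term is zero. -/
theorem not_conjLE_topSubgroup_bot [Fact p.Prime] (g : Γ ≀ᵣ CyclicGroup p) :
    ¬ ConjLE g (topSubgroup p Γ) ⊥ := by
  rw [conjLE_topSubgroup]
  intro h
  have : Nontrivial (CyclicGroup p) := by
    have : Fact (1 < p) := ⟨(Fact.out : p.Prime).one_lt⟩
    exact inferInstanceAs (Nontrivial (ZMod p))
  obtain ⟨c, hc⟩ := exists_ne (1 : CyclicGroup p)
  have h1 := Subgroup.mem_bot.1 (h c)
  apply hc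
  have h2 := congrArg RegularWreathProduct.right h1
  simpa using h2

/-- For nontrivial `A` meeting the base trivially, `A` contains a conjugate `g⁻¹ C_p g`. Then `g ξ`
is fixed by `C_p`, hence constant, and its coordinate at `1` is zero. -/
theorem diagFun_eq_zero [Fact p.Prime] {A : Subgroup (Γ ≀ᵣ CyclicGroup p)} {ξ : baseFixed ρ A}
    (h : diagFun ρ A ξ = 0) : ξ.1 ∈ atomicSubgroup (CyclicGroup p → M) A := by
  rw [mem_atomicSubgroup]
  intro hA
  by_cases hA1 : ∀ a ∈ A, a.right = 1 → a = 1
  · obtain ⟨g, hg⟩ := exists_conjLE_topSubgroup hA hA1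
    have h1 : wreathRep ρ g ξ.1 1 = 0 := by
      have := congrArg (fun s => s.1 g) h
      simpa [diagFun_apply, hg] using this
    have h2 : wreathRep ρ g ξ.1 = 0 := funext fun x => by
      rw [conjLE_topSubgroup] at hg
      have h3 := ξ.2.1 _ (hg x⁻¹)
      have h4 := congrArg (fun η => wreathRep ρ g η 1) h3
      beta_reduce at h4
      rw [← wreathRep_mul_apply, ← mul_assoc, mul_inv_cancel_left, wreathRep_mul_apply,
        wreathRep_inl_apply, h1] at h4
      simpa using h4
    have h5 := congrArg (wreathRep ρ g⁻¹) h2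
    rw [← wreathRep_mul_apply, inv_mul_cancel, map_one, map_zero] at h5
    exact h5
  · push Not at hA1
    obtain ⟨a, ha, har, ha1⟩ := hA1
    exact ξ.2.2 a ha ha1 har

/-- If `t` is nonzero at `g₀`, then `g₀ A g₀⁻¹` contains `C_p` and no nontrivial diagonal element,
so it meets the base trivially. The preimage is the constant vector `t g₀` moved back by `g₀⁻¹`. -/
theorem diagFun_surjective [Fact p.Prime] [Finite Γ] {A : Subgroup (Γ ≀ᵣ CyclicGroup p)}
    (hA : IsPGroup p A) : Function.Surjective (diagFun ρ A) := by
  intro t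
  by_cases ht : t = 0
  · exact ⟨0, by rw [map_zero, ht]⟩
  obtain ⟨g₀, hg₀⟩ : ∃ g₀, t.1 g₀ ≠ 0 := by
    by_contra! h
    exact ht (Subtype.ext (funext h))
  have hV : ConjLE g₀ (topSubgroup p Γ) A := by
    by_contra h
    exact hg₀ (t.2.2.2.1 g₀ h)
  have hV' := conjLE_topSubgroup.1 hV
  have hA1 : ∀ a ∈ A, a.right = 1 → a = 1 := by
    intro a ha har
    by_contra ha1
    let L := pointStabilizer (MonoidHom.id _) g₀ A
    obtain ⟨γ, hγ, hγL⟩ := exists_diagHom_mem (L := L) (a := g₀ * a * g₀⁻¹)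
      (isPGroup_pointStabilizer Function.injective_id g₀ hA)
      (fun c => mem_pointStabilizer.2 (hV' c)) (mem_pointStabilizer.2 (by simpa [mul_assoc] using ha))
      (fun h => ha1 (by
        have h4 := congrArg (fun x => g₀⁻¹ * x * g₀) h
        simpa [mul_assoc] using h4)) (by simp [har])
    exact hg₀ (t.2.2.2.2 g₀ γ hγ (mem_pointStabilizer.1 hγL))
  have hinj : ∀ a ∈ A, ∀ b ∈ A, a.right = b.right → a = b := fun a ha b hb hab => by
    rw [← mul_inv_eq_one]
    refine hA1 _ (A.mul_mem ha (A.inv_mem hb)) ?_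
    simp [hab]
  let ζ : CyclicGroup p → M := fun _ => t.1 g₀
  have hζ : ∀ c, wreathRep ρ (inl c) ζ = ζ := fun c => funext fun x => wreathRep_inl_apply ρ c ζ x
  have hfix : ∀ a ∈ A, wreathRep ρ a (wreathRep ρ g₀⁻¹ ζ) = wreathRep ρ g₀⁻¹ ζ := by
    intro a ha
    have h1 : a = g₀⁻¹ * inl a.right * g₀ := hinj _ ha _ (hV' _) (by simp)
    rw [h1, wreathRep_mul_apply, ← wreathRep_mul_apply ρ g₀, mul_inv_cancel, map_one,
      wreathRep_mul_apply, Module.End.one_apply, hζ]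
  refine ⟨⟨wreathRep ρ g₀⁻¹ ζ, hfix, fun a ha ha1 har => absurd (hA1 a ha har) ha1⟩,
    Subtype.ext (funext fun g => ?_)⟩
  rw [diagFun_apply]
  split_ifs with hg
  · rw [conjLE_topSubgroup] at hg
    -- Both `g` and `g₀` conjugate `C_p` into `A`, compatibly with the projection to `C_p`. So `w`
    -- centralizes `C_p` and lies in the diagonal times `C_p`, which determines `t g` from `t g₀`.
    let w := g * g₀⁻¹
    have hw : ∀ c, w * inl c = inl c * w := fun c => by
      have h1 := hinj _ (hg c) _ (hV' c) (by simp)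
      have h2 := congrArg (fun x => g * x * g₀⁻¹) h1
      simpa [w, mul_assoc] using h2.symm
    have h3 := left_eq_of_comm_inl hw
    have h4 : g = diagHom p Γ (w.left 1) * (g₀ * (g₀⁻¹ * inl w.right * g₀)) := by
      have h5 := congrArg (fun x => x * g₀) h3
      simpa [w, mul_assoc] using h5
    rw [← wreathRep_mul_apply]
    change ρ (w.left 1) (t.1 g₀) = t.1 g
    conv_rhs => rw [h4]
    rw [t.2.2.1, t.2.1 _ _ (hV' _)]
  · exact (t.2.2.2.1 g hg).symm

variable (p) in
/-- The map to the functor induced from the diagonal. -/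
noncomputable def baseFixedToDiag [Fact p.Prime] :
    baseFixedFunctor p ρ ⟶ (orbInductionDiag p Γ).funFunctor ρ where
  app A := AddCommGrpCat.ofHom (diagFun ρ A.unop.sub)
  naturality B A φ := by
    refine AddCommGrpCat.hom_ext <| AddMonoidHom.ext fun ξ => Subtype.ext <| funext fun g => ?_
    let ξ' : baseFixed ρ B.unop.sub := ξ
    let η : baseFixed ρ A.unop.sub := ((baseFixedFunctor p ρ).map φ).hom ξ
    have hη : η.1 = wreathRep ρ (Orb.rep φ.unop) ξ'.1 := rfl
    change (diagFun ρ _ η).1 g =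
      ((orbInductionDiag p Γ).equivariantFunMap ρ φ.unop (diagFun ρ _ ξ')).1 g
    rw [OrbInduction.equivariantFunMap_apply, diagFun_apply, diagFun_apply]
    split_ifs with h1 h2
    · rw [wreathRep_mul_apply, hη]
    · exact absurd (h1.comp (Orb.conjLE_rep φ.unop)) h2
    · rfl

/-- The higher limits of the atomic functor of `M^p` over the `p`-subgroups of the wreath product
are those of the atomic functor of `M`, shifted by one. -/
theorem higherLimit_orbAtomic_wreath_iso [Fact p.Prime] [Finite Γ] [Module (ZMod p) M]
    (ρ : Representation (ZMod p) Γ M) (hp : p ∣ Nat.card Γ) (i : ℕ) :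
    Nonempty (higherLimit (i + 1) (orbAtomic (pSubgroups p _) (wreathRep (p := p) ρ)) ≅
      higherLimit i (orbAtomic (pSubgroups p Γ) ρ)) := by
  let S : ShortComplex ((Orb (pSubgroups p (Γ ≀ᵣ CyclicGroup p)))ᵒᵖ ⥤ AddCommGrpCat.{u}) :=
    ShortComplex.mk (atomicToBaseFixed p ρ) (baseFixedToDiag p ρ) (by
      refine NatTrans.ext (funext fun A => AddCommGrpCat.hom_ext <| AddMonoidHom.ext fun ξ =>
        Subtype.ext <| funext fun g => ?_)
      let ξ' : atomicSubgroup (CyclicGroup p → M) A.unop.sub := ξ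
      change (diagFun ρ _ (AddSubgroup.inclusion (atomicSubgroup_le_baseFixed ρ A.unop.sub) ξ')).1 g
        = 0
      rw [diagFun_apply]
      split_ifs with hg
      · have h1 : ξ'.1 = 0 := mem_atomicSubgroup.1 ξ'.2 (fun hA =>
          not_conjLE_topSubgroup_bot g (hA ▸ hg))
        change wreathRep ρ g ξ'.1 1 = 0
        rw [h1, map_zero, Pi.zero_apply]
      · rfl)
  have hS : S.ShortExact := shortExact_of_app S
    (fun A => AddSubgroup.inclusion_injective (atomicSubgroup_le_baseFixed ρ A.unop.sub))
    (fun A => diagFun_surjective ρ A.unop.mem)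
    (fun A ξ h => ⟨⟨_, diagFun_eq_zero ρ (ξ := ξ) h⟩, Subtype.ext rfl⟩)
  obtain ⟨e⟩ := higherLimit_succ_iso_of_shortExact hS
    (isZero_higherLimit_baseFixedFunctor ρ hp) i
  obtain ⟨e'⟩ := (orbInductionDiag p Γ).higherLimit_funFunctor_iso ρ i
  exact ⟨e ≪≫ e'⟩

end Diagonal

/-! ### From subgroups of a Sylow subgroup to all `p`-subgroups -/

section Sylow

variable {p : ℕ} {G : Type u} [Group G] {k : Type*} [CommRing k] {M : Type u}
  [AddCommGroup M] [Module k M]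

/-- The inclusion of the orbit category of subgroups of a Sylow subgroup `T` into the orbit
category of all `p`-subgroups. -/
def sylowInclusion (T : Sylow p G) : OrbitCat (T : Subgroup G) ⥤ Orb (pSubgroups p G) where
  obj P := ⟨P.toSubgroup, T.2.to_le P.le⟩
  map φ := φ

instance (T : Sylow p G) : (sylowInclusion T).Full := ⟨fun φ => ⟨φ, rfl⟩⟩

instance (T : Sylow p G) : (sylowInclusion T).Faithful := ⟨fun h => h⟩

theorem sylowInclusion_essSurj [Fact p.Prime] [Finite G] (T : Sylow p G) :
    (sylowInclusion T).EssSurj where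
  mem_essImage P := by
    obtain ⟨T', hT'⟩ := IsPGroup.exists_le_sylow P.mem
    obtain ⟨g, hg⟩ := MulAction.exists_smul_eq G T' T
    -- Conjugate subgroups are isomorphic objects of the orbit category, so a conjugate inside `T`
    -- suffices.
    let P' : Subgroup G := P.sub.map (MulAut.conj g).toMonoidHom
    have hP' : P' ≤ T := by
      rintro _ ⟨x, hx, rfl⟩
      rw [← hg]
      exact Subgroup.smul_mem_pointwise_smul x (MulAut.conj g) _ (hT' hx)
    let Q : OrbitCat (T : Subgroup G) := ⟨P', hP'⟩
    have h1 : ConjLE g ((sylowInclusion T).obj Q).sub P.sub := by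
      rintro _ ⟨x, hx, rfl⟩
      simpa [mul_assoc] using hx
    have h2 : ConjLE g⁻¹ P.sub ((sylowInclusion T).obj Q).sub := fun x hx =>
      ⟨x, hx, by simp⟩
    have hid : ∀ (R : Orb (pSubgroups p G)) (h : ConjLE 1 R.sub R.sub),
        Orb.homMk 1 h = 𝟙 R := fun R h => Orb.hom_ext fun x => by
      rw [Orb.toMap_homMk, mul_one]
      rfl
    refine ⟨Q, ⟨⟨Orb.homMk g h1, Orb.homMk g⁻¹ h2, ?_, ?_⟩⟩⟩
    · rw [Orb.homMk_comp]
      simp only [mul_inv_cancel]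
      exact hid _ _
    · rw [Orb.homMk_comp]
      simp only [inv_mul_cancel]
      exact hid _ _

/-- `Λ^i(G; M)` can be computed with all `p`-subgroups of `G`. -/
theorem lambda_iso [Fact p.Prime] [Finite G] (T : Sylow p G) (i : ℕ)
    (ρ : Representation k G M) :
    Nonempty (Lambda T i ρ ≅ higherLimit i (orbAtomic (pSubgroups p G) ρ)) := by
  have := sylowInclusion_essSurj T
  have : (sylowInclusion T).IsEquivalence := { }
  obtain ⟨e⟩ := higherLimit_comp_iso_of_isEquivalence (Φ := sylowInclusion T) i
    (orbAtomic (pSubgroups p G) ρ)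
  have e' : atomicFunctor (T : Subgroup G) ρ ≅
      (sylowInclusion T).op ⋙ orbAtomic (pSubgroups p G) ρ :=
    NatIso.ofComponents (fun P => Iso.refl _) (fun _ => rfl)
  exact ⟨higherLimitIso i e' ≪≫ e⟩

end Sylow

theorem lemma2p5 {p : ℕ} [Fact p.Prime] {Γ : Type u} [Group Γ] [Finite Γ]
    (hp : p ∣ Nat.card Γ)
    {M : Type u} [AddCommGroup M] [Module (ZMod p) M] (ρ : Representation (ZMod p) Γ M)
    (T : Sylow p Γ) (S : Sylow p (Γ ≀ᵣ CyclicGroup p)) (i : ℕ) (hi : 1 ≤ i) :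
    Nonempty (Lambda S i (wreathRep (p := p) ρ) ≅ Lambda T (i - 1) ρ) := by
  have : NeZero p := ⟨(Fact.out : p.Prime).ne_zero⟩
  have : Finite (CyclicGroup p) := inferInstanceAs (Finite (ZMod p))
  obtain ⟨i, rfl⟩ := Nat.exists_eq_add_of_le' hi
  obtain ⟨e₁⟩ := lambda_iso S (i + 1) (wreathRep (p := p) ρ)
  obtain ⟨e₂⟩ := higherLimit_orbAtomic_wreath_iso ρ hp i
  obtain ⟨e₃⟩ := lambda_iso T i ρ
  exact ⟨e₁ ≪≫ e₂ ≪≫ e₃.symm⟩
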